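/- **Conventions.** $C^*$-algebras are unital and non-zero. For a $C^*$-algebra $\mathfrak A$, $\mathfrak{sa}(\mathfrak A)$ is its self-adjoint part, $\mathscr S(\mathfrak A)$ its state space, $\Re a=\frac12(a+a^*)$ and $\Im a=\frac1{2i}(a-a^*)$. Seminorms defined on a subspace are extended by the value $\infty$ outside it, and $\operatorname{dom}$ denotes the set where they are finite. A pair $(F,H)$ of functions $F:[0,\infty)^4\to[0,\infty)$, $H:[0,\infty)^2\to[0,\infty)$ is *permissible* if both are weakly increasing for the product order, $F(x,y,l_x,l_y)\ge x l_y+y l_x$ and $H(x,y)\ge 2xy$. Fix a permissible pair $(F,H)$. An *$F$-quasi-Leibniz quantum compact metric space* $(\mathfrak A,\mathsf L)$ is a unital $C^*$-algebra with a seminorm $\mathsf L$ on a dense Jordan–Lie subalgebra $\operatorname{dom}(\mathsf L)$ of $\mathfrak{sa}(\mathfrak A)$ such that $\{\mathsf L=0\}=\mathbb R 1_{\mathfrak A}$; the Monge–Kantorovich metric $\mathsf{mk}_{\mathsf L}(\varphi,\psi)=\sup\{|\varphi(a)-\psi(a)|:\mathsf L(a)\le1\}$ metrizes the weak* topology of $\mathscr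 S(\mathfrak A)$; $\mathsf L:\mathfrak{sa}(\mathfrak A)\to[0,\infty]$ is lower semicontinuous; and $\max\{\mathsf L(\Re(ab)),\mathsf L(\Im(ab))\}\le F(\|a\|,\|b\|,\mathsf L(a),\mathsf L(b))$ for $a,b\in\operatorname{dom}(\mathsf L)$. A *quantum isometry* $\theta:(\mathfrak A,\mathsf L_{\mathfrak A})\to(\mathfrak B,\mathsf L_{\mathfrak B})$ is a surjective unital $*$-morphism with $\mathsf L_{\mathfrak B}(b)=\inf\{\mathsf L_{\mathfrak A}(a):a\in\mathfrak{sa}(\mathfrak A),\ \theta(a)=b\}$ for all $b\in\mathfrak{sa}(\mathfrak B)$. An *$(F,H)$-metrized quantum vector bundle* $(\mathscr M,\langle\cdot,\cdot\rangle,\mathsf D,\mathfrak A,\mathsf L)$ is an $F$-quasi-Leibniz quantum compact metric space $(\mathfrak A,\mathsf L)$, a left Hilbert $\mathfrak A$-module $\mathscr M$ (inner product $\mathfrak A$-linear in the first variable, norm $\|\omega\|=\|\langle\omega,\omega\rangle\|^{1/2}$ complete), and a norm $\mathsf D$ on a dense $\mathbb C$-linear subspace of $\mathscr M$ such that $\|\omega\|\le\mathsf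 D(\omega)$, the set $\{\mathsf D\le1\}$ is compact in $\mathscr M$, and $\max\{\mathsf L(\Re\langle\omega,\eta\rangle),\mathsf L(\Im\langle\omega,\eta\rangle)\}\le H(\mathsf D(\omega),\mathsf D(\eta))$ for $\omega,\eta\in\operatorname{dom}(\mathsf D)$. A *modular quantum isometry* $(\theta,\Theta)$ from $(\mathscr M,\langle\cdot,\cdot\rangle,\mathsf D_{\mathscr M},\mathfrak A,\mathsf L_{\mathfrak A})$ to $(\mathscr N,\langle\cdot,\cdot\rangle,\mathsf D_{\mathscr N},\mathfrak B,\mathsf L_{\mathfrak B})$ is a quantum isometry $\theta$ of the bases with a surjective $\mathbb C$-linear map $\Theta:\mathscr M\to\mathscr N$ such that $\Theta(a\omega)=\theta(a)\Theta(\omega)$, $\theta(\langle\omega,\eta\rangle)=\langle\Theta(\omega),\Theta(\eta)\rangle$, and $\mathsf D_{\mathscr N}(\omega)=\inf\{\mathsf D_{\mathscr M}(\eta):\Theta(\eta)=\omega\}$ for all $\omega\in\mathscr N$. An *$(F,H)$-modular tunnel* $\tau=(\mathbb D,(\theta_1,\Theta_1),(\theta_2,\Theta_2))$ from $\mathbb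 A_1$ to $\mathbb A_2$ is an $(F,H)$-metrized quantum vector bundle $\mathbb D$ with modular quantum isometries $(\theta_j,\Theta_j):\mathbb D\to\mathbb A_j$. If $(\mathfrak D,\mathsf L)$ and $\mathfrak A_j$ are the bases of $\mathbb D$ and $\mathbb A_j$, its *extent* is $$\chi(\tau)=\max_{j\in\{1,2\}}\operatorname{Haus}_{\mathsf{mk}_{\mathsf L}}\bigl(\mathscr S(\mathfrak D),\{\varphi\circ\theta_j:\varphi\in\mathscr S(\mathfrak A_j)\}\bigr).$$ **Theorem.** Let $\mathbb A,\mathbb B,\mathbb E$ be $(F,H)$-metrized quantum vector bundles, where $\mathbb B$ has module $\mathscr M$ and base algebra $\mathfrak B$. Let $\tau_1=(\mathbb D_1,(\theta_{\mathfrak A},\Theta_{\mathfrak A}),(\theta_{\mathfrak B},\Theta_{\mathfrak B}))$ be an $(F,H)$-modular tunnel from $\mathbb A$ to $\mathbb B$ with $\mathbb D_1=(\mathscr P,\langle\cdot,\cdot\rangle_{\mathscr P},\mathsf D_1,\mathfrak D_1,\mathsf L_1)$, let $\tau_2=(\mathbb D_2,(\pi_{\mathfrak B},\Pi_{\mathfrak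 B}),(\pi_{\mathfrak E},\Pi_{\mathfrak E}))$ be an $(F,H)$-modular tunnel from $\mathbb B$ to $\mathbb E$ with $\mathbb D_2=(\mathscr R,\langle\cdot,\cdot\rangle_{\mathscr R},\mathsf D_2,\mathfrak D_2,\mathsf L_2)$, and let $\varepsilon>0$. Let $\mathfrak D=\mathfrak D_1\oplus\mathfrak D_2$ and, for $(d_1,d_2)\in\mathfrak{sa}(\mathfrak D)$, $$\mathsf L(d_1,d_2)=\max\Bigl\{\mathsf L_1(d_1),\ \mathsf L_2(d_2),\ \tfrac1\varepsilon\|\theta_{\mathfrak B}(d_1)-\pi_{\mathfrak B}(d_2)\|_{\mathfrak B}\Bigr\}.$$ Let $\mathscr B=\mathscr P\oplus\mathscr R$, a Hilbert $\mathfrak D$-module for $(d_1,d_2)\cdot(\omega_1,\omega_2)=(d_1\omega_1,d_2\omega_2)$ and $\langle(\omega_1,\omega_2),(\eta_1,\eta_2)\rangle_{\mathscr B}=(\langle\omega_1,\eta_1\rangle_{\mathscr P},\langle\omega_2,\eta_2\rangle_{\mathscr R})$, and for $(\omega,\eta)\in\mathscr B$ let $$\mathsf D(\omega,\eta)=\max\Bigl\{\mathsf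 D_1(\omega),\ \mathsf D_2(\eta),\ \tfrac1\varepsilon\|\Theta_{\mathfrak B}(\omega)-\Pi_{\mathfrak B}(\eta)\|_{\mathscr M}\Bigr\}.$$ Then $\mathbb D=(\mathscr B,\langle\cdot,\cdot\rangle_{\mathscr B},\mathsf D,\mathfrak D,\mathsf L)$ is an $(F,H)$-metrized quantum vector bundle. With $\chi_{\mathfrak A}(d_1,d_2)=\theta_{\mathfrak A}(d_1)$, $\Xi_{\mathfrak A}(\omega,\eta)=\Theta_{\mathfrak A}(\omega)$, $\upsilon_{\mathfrak E}(d_1,d_2)=\pi_{\mathfrak E}(d_2)$ and $\Upsilon_{\mathfrak E}(\omega,\eta)=\Pi_{\mathfrak E}(\eta)$, the triple $\tau=(\mathbb D,(\chi_{\mathfrak A},\Xi_{\mathfrak A}),(\upsilon_{\mathfrak E},\Upsilon_{\mathfrak E}))$ is an $(F,H)$-modular tunnel from $\mathbb A$ to $\mathbb E$, and $$\chi(\tau)\le\chi(\tau_1)+\chi(\tau_2)+\varepsilon.$$ -/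

import Mathlib

open scoped NNReal ENNReal ComplexOrder ComplexStarModule CStarAlgebra

universe u v u₁ v₁ u₂ v₂ u₃ v₃ u₄ v₄

noncomputable section

/-! ### Permissible functions -/

/-- A permissible function `F : [0,∞)⁴ → [0,∞)`. -/
structure IsPermissible (F : ℝ≥0 → ℝ≥0 → ℝ≥0 → ℝ≥0 → ℝ≥0) : Prop where
  mono : ∀ x x' y y' l l' m m' : ℝ≥0, x ≤ x' → y ≤ y' → l ≤ l' → m ≤ m' →
    F x y l m ≤ F x' y' l' m'
  bound : ∀ x y l m : ℝ≥0, x * m + y * l ≤ F x y l m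

/-- A permissible pair `(F, H)`. -/
structure IsPermissiblePair (F : ℝ≥0 → ℝ≥0 → ℝ≥0 → ℝ≥0 → ℝ≥0) (H : ℝ≥0 → ℝ≥0 → ℝ≥0) :
    Prop where
  fst : IsPermissible F
  mono : ∀ x x' y y' : ℝ≥0, x ≤ x' → y ≤ y' → H x y ≤ H x' y'
  bound : ∀ x y : ℝ≥0, 2 * x * y ≤ H x y

/-! ### States and the Monge-Kantorovich metric -/

/-- The state space of a unital C*-algebra, with the weak* topology. -/
abbrev StateSpace (A : Type*) [CStarAlgebra A] : Type _ :=
  {φ : WeakDual ℂ A // φ 1 = 1 ∧ ∀ a : A, 0 ≤ φ (star a * a)}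

/-- The map `φ ↦ φ ∘ π` between state spaces, for a unital *-morphism `π`. -/
def StateSpace.pullback {D A : Type*} [CStarAlgebra D] [CStarAlgebra A] (π : D →⋆ₐ[ℂ] A)
    (φ : StateSpace A) : StateSpace D :=
  ⟨StrongDual.toWeakDual ((WeakDual.toStrongDual φ.1).comp
      (⟨π.toAlgHom.toLinearMap, map_continuous π⟩ : D →L[ℂ] A)), by
    refine ⟨?_, fun a => ?_⟩
    · change φ.1 (π 1) = 1
      rw [map_one]
      exact φ.2.1
    · change 0 ≤ φ.1 (π (star a * a))
      rw [map_mul, map_star]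
      exact φ.2.2 (π a)⟩

/-- The Monge-Kantorovich (extended pseudo-)metric of `L : sa(A) → [0,∞]`:
`mk_L(φ, ψ) = sup {|φ(a) - ψ(a)| : L(a) ≤ 1}`. -/
def mkDist {A : Type*} [CStarAlgebra A] (L : selfAdjoint A → ℝ≥0∞) (φ ψ : StateSpace A) : ℝ≥0∞ :=
  ⨆ (a : selfAdjoint A) (_ : L a ≤ 1), ‖φ.1 (a : A) - ψ.1 (a : A)‖ₑ

/-- `mkDist` as an extended pseudo-metric. -/
@[reducible] def mkEMetric {A : Type*} [CStarAlgebra A] (L : selfAdjoint A → ℝ≥0∞) :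
    PseudoEMetricSpace (StateSpace A) where
  edist := mkDist L
  edist_self φ := by simp [mkDist]
  edist_comm φ ψ := by
    unfold mkDist
    refine iSup_congr fun a => iSup_congr fun _ => ?_
    rw [← enorm_neg, neg_sub]
  edist_triangle φ ψ ξ := by
    refine iSup₂_le fun a ha => ?_
    have h : φ.1 (a : A) - ξ.1 (a : A) =
        (φ.1 (a : A) - ψ.1 (a : A)) + (ψ.1 (a : A) - ξ.1 (a : A)) := by ring
    rw [h]
    refine (enorm_add_le _ _).trans (add_le_add ?_ ?_)
    · exact le_iSup₂ (f := fun (a : selfAdjoint A) (_ : L a ≤ 1) =>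
        ‖φ.1 (a : A) - ψ.1 (a : A)‖ₑ) a ha
    · exact le_iSup₂ (f := fun (a : selfAdjoint A) (_ : L a ≤ 1) =>
        ‖ψ.1 (a : A) - ξ.1 (a : A)‖ₑ) a ha

/-! ### Quantum compact metric spaces -/

/-- `(A, L)` is an `F`-quasi-Leibniz quantum compact metric space. The seminorm is extended by `∞`
outside its domain, so that `dom L = {a | L a ≠ ∞}`. The domain is a Jordan-Lie subalgebra by
`leibniz`: for self-adjoint `a`, `b`, the elements `ℜ (a * b)` and `ℑ (a * b)` are the Jordan
product `(ab + ba) / 2` and the Lie product `(ab - ba) / 2i`. -/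
structure IsQuantumCompactMetricSpace (F : ℝ≥0 → ℝ≥0 → ℝ≥0 → ℝ≥0 → ℝ≥0) {A : Type*}
    [CStarAlgebra A] (L : selfAdjoint A → ℝ≥0∞) : Prop where
  nontrivial : Nontrivial A
  add_le : ∀ a b : selfAdjoint A, L (a + b) ≤ L a + L b
  smul : ∀ (t : ℝ) (a : selfAdjoint A), L (t • a) = ‖t‖ₑ * L a
  dense_dom : Dense {a : selfAdjoint A | L a ≠ ∞}
  ker : {a : selfAdjoint A | L a = 0} = Set.range fun t : ℝ => t • (1 : selfAdjoint A)
  mk_ne_top : ∀ φ ψ : StateSpace A, mkDist L φ ψ ≠ ∞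
  mk_topology : (mkEMetric L).toUniformSpace.toTopologicalSpace =
    (inferInstance : TopologicalSpace (StateSpace A))
  lsc : LowerSemicontinuous L
  leibniz : ∀ a b : selfAdjoint A, L a ≠ ∞ → L b ≠ ∞ →
    max (L (ℜ ((a : A) * (b : A)))) (L (ℑ ((a : A) * (b : A)))) ≤
      (F ‖(a : A)‖₊ ‖(b : A)‖₊ (L a).toNNReal (L b).toNNReal : ℝ≥0∞)

/-- The element `π(a)` of `sa(B)`, for a *-morphism `π : A → B` and `a ∈ sa(A)`. -/
def saMap {A B : Type*} [CStarAlgebra A] [CStarAlgebra B] (π : A →⋆ₐ[ℂ] B) (a : selfAdjoint A) :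
    selfAdjoint B :=
  ⟨π a, by rw [selfAdjoint.mem_iff, ← map_star, selfAdjoint.mem_iff.mp a.2]⟩

/-- A quantum isometry: a surjective unital *-morphism `π` such that
`L_B(b) = inf {L_A(a) : a ∈ sa(A), π(a) = b}` for all `b ∈ sa(B)`. -/
structure IsQuantumIsometry {A B : Type*} [CStarAlgebra A] [CStarAlgebra B]
    (LA : selfAdjoint A → ℝ≥0∞) (LB : selfAdjoint B → ℝ≥0∞) (π : A →⋆ₐ[ℂ] B) : Prop where
  surjective : Function.Surjective π
  quotient : ∀ b : selfAdjoint B, LB b = ⨅ (a : selfAdjoint A) (_ : saMap π a = b), LA a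

/-- The extent of the tunnel `(D, L, π₁, π₂)`: the larger of the Hausdorff distances, for the
Monge-Kantorovich metric of `L`, between the state space of `D` and the set of the states
`φ ∘ π_j`, where `φ` is a state of `A_j`. -/
def tunnelExtent {D A₁ A₂ : Type*} [CStarAlgebra D] [CStarAlgebra A₁] [CStarAlgebra A₂]
    (L : selfAdjoint D → ℝ≥0∞) (π₁ : D →⋆ₐ[ℂ] A₁) (π₂ : D →⋆ₐ[ℂ] A₂) : ℝ≥0∞ :=
  max
    (@Metric.hausdorffEDist (StateSpace D) (mkEMetric L)
      Set.univ (Set.range (StateSpace.pullback π₁)))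
    (@Metric.hausdorffEDist (StateSpace D) (mkEMetric L)
      Set.univ (Set.range (StateSpace.pullback π₂)))

/-! ### Metrized quantum vector bundles -/


/-- The data `(M, ⟨·,·⟩, D, A, L)`: a left Hilbert module `M` over a unital C*-algebra `A`, with
functions `L : sa(A) → [0,∞]` and `D : M → [0,∞]`. In Mathlib's `CStarModule` the inner product
is `A`-linear in its second variable, so that the pairing `⟨ω, η⟩`, which is `A`-linear in `ω`,
is `inner A η ω`. -/
structure BundleData where
  Alg : Type u
  Mod : Type v
  [cstar : CStarAlgebra Alg]
  [order : PartialOrder Alg]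
  [starOrdered : StarOrderedRing Alg]
  [normedGroup : NormedAddCommGroup Mod]
  [normedSpace : NormedSpace ℂ Mod]
  [complete : CompleteSpace Mod]
  [module : Module Alg Mod]
  [hilbert : CStarModule Alg Mod]
  L : selfAdjoint Alg → ℝ≥0∞
  D : Mod → ℝ≥0∞

attribute [instance] BundleData.cstar BundleData.order BundleData.starOrdered
  BundleData.normedGroup BundleData.normedSpace BundleData.complete BundleData.module
  BundleData.hilbert

/-- The `A`-valued pairing `⟨ω, η⟩`, with `⟨a ω, η⟩ = a ⟨ω, η⟩`. -/
def BundleData.pairing (X : BundleData.{u, v}) (ω η : X.Mod) : X.Alg := inner X.Alg η ω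

/-- `X` is an `(F, H)`-metrized quantum vector bundle. The D-norm is extended by `∞` outside its
domain; it is definite on its domain by `norm_le`. -/
structure IsMetrizedBundle (F : ℝ≥0 → ℝ≥0 → ℝ≥0 → ℝ≥0 → ℝ≥0) (H : ℝ≥0 → ℝ≥0 → ℝ≥0)
    (X : BundleData.{u, v}) : Prop where
  base : IsQuantumCompactMetricSpace F X.L
  add_le : ∀ ω η : X.Mod, X.D (ω + η) ≤ X.D ω + X.D η
  smul : ∀ (z : ℂ) (ω : X.Mod), X.D (z • ω) = ‖z‖ₑ * X.D ω
  dense_dom : Dense {ω : X.Mod | X.D ω ≠ ∞}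
  norm_le : ∀ ω : X.Mod, ‖ω‖ₑ ≤ X.D ω
  compact_ball : IsCompact {ω : X.Mod | X.D ω ≤ 1}
  inner_leibniz : ∀ ω η : X.Mod, X.D ω ≠ ∞ → X.D η ≠ ∞ →
    max (X.L (ℜ (X.pairing ω η))) (X.L (ℑ (X.pairing ω η))) ≤
      (H (X.D ω).toNNReal (X.D η).toNNReal : ℝ≥0∞)

/-- `(θ, Θ)` is a modular quantum isometry from `X` to `Y`. -/
structure IsModularIsometry (X : BundleData.{u₁, v₁}) (Y : BundleData.{u₂, v₂})
    (θ : X.Alg →⋆ₐ[ℂ] Y.Alg) (Θ : X.Mod →ₗ[ℂ] Y.Mod) : Prop where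
  map_smul : ∀ (a : X.Alg) (ω : X.Mod), Θ (a • ω) = θ a • Θ ω
  map_pairing : ∀ ω η : X.Mod, θ (X.pairing ω η) = Y.pairing (Θ ω) (Θ η)
  base : IsQuantumIsometry X.L Y.L θ
  surjective : Function.Surjective Θ
  quotient : ∀ ω : Y.Mod, Y.D ω = ⨅ (η : X.Mod) (_ : Θ η = ω), X.D η

/-- The data `(X, (θ₁, Θ₁), (θ₂, Θ₂))` of a modular tunnel from `A` to `B`. -/
structure TunnelData (A : BundleData.{u₁, v₁}) (B : BundleData.{u₂, v₂}) where
  bundle : BundleData.{u, v}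
  algFst : bundle.Alg →⋆ₐ[ℂ] A.Alg
  modFst : bundle.Mod →ₗ[ℂ] A.Mod
  algSnd : bundle.Alg →⋆ₐ[ℂ] B.Alg
  modSnd : bundle.Mod →ₗ[ℂ] B.Mod

/-- `τ` is an `(F, H)`-modular tunnel from `A` to `B`. -/
structure IsModularTunnel (F : ℝ≥0 → ℝ≥0 → ℝ≥0 → ℝ≥0 → ℝ≥0) (H : ℝ≥0 → ℝ≥0 → ℝ≥0)
    {A : BundleData.{u₁, v₁}} {B : BundleData.{u₂, v₂}} (τ : TunnelData.{u, v} A B) : Prop where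
  bundle : IsMetrizedBundle F H τ.bundle
  fst : IsModularIsometry τ.bundle A τ.algFst τ.modFst
  snd : IsModularIsometry τ.bundle B τ.algSnd τ.modSnd

/-- The extent of a modular tunnel, that is, of its basic tunnel. -/
def TunnelData.extent {A : BundleData.{u₁, v₁}} {B : BundleData.{u₂, v₂}}
    (τ : TunnelData.{u, v} A B) : ℝ≥0∞ :=
  tunnelExtent τ.bundle.L τ.algFst τ.algSnd

/-! ### The direct sum of two tunnels -/

/-- The action `(a, b) • (ω, η) = (a • ω, b • η)` of `R × S` on `P × Q`. -/
@[reducible] def prodModule (R S P Q : Type*) [Ring R] [Ring S] [AddCommGroup P] [AddCommGroup Q]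
    [Module R P] [Module S Q] : Module (R × S) (P × Q) where
  smul a ω := (a.1 • ω.1, a.2 • ω.2)
  one_smul ω := Prod.ext (one_smul R ω.1) (one_smul S ω.2)
  mul_smul a b ω := Prod.ext (mul_smul a.1 b.1 ω.1) (mul_smul a.2 b.2 ω.2)
  smul_zero a := Prod.ext (smul_zero a.1) (smul_zero a.2)
  smul_add a ω η := Prod.ext (smul_add a.1 ω.1 η.1) (smul_add a.2 ω.2 η.2)
  add_smul a b ω := Prod.ext (add_smul a.1 b.1 ω.1) (add_smul a.2 b.2 ω.2)
  zero_smul ω := Prod.ext (zero_smul R ω.1) (zero_smul S ω.2)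

/-- The Hilbert module structure on `P × Q` over `R × S`, with
`⟨(ω₁, ω₂), (η₁, η₂)⟩ = (⟨ω₁, η₁⟩, ⟨ω₂, η₂⟩)`; its norm is the maximum of the norms. -/
@[reducible] def prodHilbert (R S P Q : Type*) [CStarAlgebra R] [PartialOrder R]
    [CStarAlgebra S] [PartialOrder S] [NormedAddCommGroup P] [NormedSpace ℂ P]
    [NormedAddCommGroup Q] [NormedSpace ℂ Q] [Module R P] [Module S Q]
    [CStarModule R P] [CStarModule S Q] :
    @CStarModule (R × S) (P × Q) _ _ _ _ _ _ (prodModule R S P Q).toSMul _ _ :=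
  letI := prodModule R S P Q
  { inner := fun ω η => (inner R ω.1 η.1, inner S ω.2 η.2)
    inner_add_right := Prod.ext CStarModule.inner_add_right CStarModule.inner_add_right
    inner_self_nonneg := ⟨CStarModule.inner_self_nonneg, CStarModule.inner_self_nonneg⟩
    inner_self := by
      intro x
      simp only [Prod.ext_iff, Prod.fst_zero, Prod.snd_zero, CStarModule.inner_self]
    inner_op_smul_right :=
      Prod.ext CStarModule.inner_op_smul_right CStarModule.inner_op_smul_right
    inner_smul_right_complex :=
      Prod.ext CStarModule.inner_smul_right_complex CStarModule.inner_smul_right_complex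
    star_inner := fun x y => Prod.ext (CStarModule.star_inner _ _) (CStarModule.star_inner _ _)
    norm_eq_sqrt_norm_inner_self := fun x => by
      rw [Prod.norm_def, Prod.norm_def, Real.sqrt_monotone.map_max,
        CStarModule.norm_eq_sqrt_norm_inner_self (A := R) x.1,
        CStarModule.norm_eq_sqrt_norm_inner_self (A := S) x.2] }

/-- `L(d₁, d₂) = max {L₁(d₁), L₂(d₂), ‖θ(d₁) - π(d₂)‖ / ε}` for `(d₁, d₂) ∈ sa(D₁ ⊕ D₂)`. -/
def sumL {D₁ D₂ B : Type*} [CStarAlgebra D₁] [CStarAlgebra D₂] [CStarAlgebra B]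
    (L₁ : selfAdjoint D₁ → ℝ≥0∞) (L₂ : selfAdjoint D₂ → ℝ≥0∞)
    (θ : D₁ →⋆ₐ[ℂ] B) (π : D₂ →⋆ₐ[ℂ] B) (ε : ℝ) (d : selfAdjoint (D₁ × D₂)) : ℝ≥0∞ :=
  max (max (L₁ (saMap (StarAlgHom.fst ℂ D₁ D₂) d)) (L₂ (saMap (StarAlgHom.snd ℂ D₁ D₂) d)))
    (ENNReal.ofReal (1 / ε * ‖θ (d : D₁ × D₂).1 - π (d : D₁ × D₂).2‖))

/-- `D(ω, η) = max {D₁(ω), D₂(η), ‖Θ(ω) - Ξ(η)‖ / ε}`. -/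
def sumD {P R M : Type*} [NormedAddCommGroup P] [NormedSpace ℂ P] [NormedAddCommGroup R]
    [NormedSpace ℂ R] [NormedAddCommGroup M] [NormedSpace ℂ M]
    (D₁ : P → ℝ≥0∞) (D₂ : R → ℝ≥0∞) (Θ : P →ₗ[ℂ] M) (Ξ : R →ₗ[ℂ] M) (ε : ℝ)
    (ω : P × R) : ℝ≥0∞ :=
  max (max (D₁ ω.1) (D₂ ω.2)) (ENNReal.ofReal (1 / ε * ‖Θ ω.1 - Ξ ω.2‖))

/-- The direct sum of the bundles of a tunnel from `A` to `B` and a tunnel from `B` to `E`. -/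
def TunnelData.sumBundle {A : BundleData.{u₁, v₁}} {B : BundleData.{u₂, v₂}}
    {E : BundleData.{u₃, v₃}} (τ₁ : TunnelData.{u, v} A B) (τ₂ : TunnelData.{u₄, v₄} B E) (ε : ℝ) :
    BundleData.{max u u₄, max v v₄} where
  Alg := τ₁.bundle.Alg × τ₂.bundle.Alg
  Mod := τ₁.bundle.Mod × τ₂.bundle.Mod
  module := prodModule τ₁.bundle.Alg τ₂.bundle.Alg τ₁.bundle.Mod τ₂.bundle.Mod
  hilbert := prodHilbert τ₁.bundle.Alg τ₂.bundle.Alg τ₁.bundle.Mod τ₂.bundle.Mod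
  L := sumL τ₁.bundle.L τ₂.bundle.L τ₁.algSnd τ₂.algFst ε
  D := sumD τ₁.bundle.D τ₂.bundle.D τ₁.modSnd τ₂.modFst ε

/-- The tunnel from `A` to `E` with bundle `sumBundle`, and with maps
`(d₁, d₂) ↦ θ_A(d₁)`, `(ω, η) ↦ Θ_A(ω)` and `(d₁, d₂) ↦ π_E(d₂)`, `(ω, η) ↦ Π_E(η)`. -/
def TunnelData.compose {A : BundleData.{u₁, v₁}} {B : BundleData.{u₂, v₂}}
    {E : BundleData.{u₃, v₃}} (τ₁ : TunnelData.{u, v} A B) (τ₂ : TunnelData.{u₄, v₄} B E) (ε : ℝ) :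
    TunnelData.{max u u₄, max v v₄} A E where
  bundle := τ₁.sumBundle τ₂ ε
  algFst := τ₁.algFst.comp (StarAlgHom.fst ℂ τ₁.bundle.Alg τ₂.bundle.Alg)
  modFst := τ₁.modFst ∘ₗ LinearMap.fst ℂ τ₁.bundle.Mod τ₂.bundle.Mod
  algSnd := τ₂.algSnd.comp (StarAlgHom.snd ℂ τ₁.bundle.Alg τ₂.bundle.Alg)
  modSnd := τ₂.modSnd ∘ₗ LinearMap.snd ℂ τ₁.bundle.Mod τ₂.bundle.Mod

end

noncomputable section

open Filter Topology

/-! ### Positive functionals and states -/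

section Positive

variable {A : Type*} [CStarAlgebra A]

/-! A state of `D₁ × D₂` is a convex combination `s φ₁ + t φ₂` of states of the summands, with
weights its values at `(1, 0)` and `(0, 1)` (`StateSpace.apply_eq_corner_add_corner`). Two such
states differ by `s (φ₁ - ψ₁) + t (φ₂ - ψ₂) + (s - s') (ψ₁ - ψ₂)`. The last difference is bridged
through a state `μ` of `B`: from `ψ₁` to `μ ∘ θ`, then to `μ ∘ π` at cost at most `ε`, then to `ψ₂`
(`mkDist_sumL_le`). This makes the new metric finite and weak* continuous. The normalized
restriction `φ₁` may jump where its weight vanishes, but there the weight absorbs a bounded distance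
(`tendsto_enorm_mul_mkDist_corner`). Conversely, metric convergence implies weak* convergence
because the domain of the seminorm is dense.

The Leibniz inequalities for the bridge terms come from `x y - x' y' = (x - x') y + x' (y - y')` and
its analogue for inner products; the lower bounds on `F` and `H` are what these identities require.
The maps are quotient maps because an element of one summand can be paired with a lift, at almost no
greater cost, of its image in `B`, and the bridge term of such a pair is zero.

For the extent, `φ₁` is moved directly to a state of the target `A`, while `φ₂` is moved to some `μ
∘ π`, across the bridge to `μ ∘ θ`, and then to a state of `A`. Convexity combines the two
(`exists_mkDist_pullback_comp_le`); the target `E` is symmetric. -/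

theorem norm_apply_le_of_positive_of_isSelfAdjoint (f : A →ₗ[ℂ] ℂ)
    (hf : ∀ a, 0 ≤ f (star a * a)) {a : A} (ha : IsSelfAdjoint a) : ‖f a‖ ≤ ‖a‖ * ‖f 1‖ := by
  let _ := CStarAlgebra.spectralOrder A
  let _ := CStarAlgebra.spectralOrderedRing A
  have hpos : ∀ x : A, 0 ≤ x → 0 ≤ f x := fun x hx => by
    obtain ⟨y, rfl⟩ := CStarAlgebra.nonneg_iff_eq_star_mul_self.mp hx
    exact hf y
  have hone : 0 ≤ f 1 := by simpa using hf 1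
  have hsm : f (algebraMap ℝ A ‖a‖) = (‖a‖ : ℂ) * f 1 := by
    rw [Algebra.algebraMap_eq_smul_one, ← Complex.coe_smul, map_smul, smul_eq_mul]
  have h₁ := hpos _ (sub_nonneg.mpr ha.le_algebraMap_norm_self)
  have h₂ := hpos _ (sub_nonneg.mpr ha.neg_algebraMap_norm_le_self)
  rw [map_sub, hsm] at h₁
  rw [map_sub, map_neg, hsm] at h₂
  obtain ⟨r, hr, hr'⟩ : ∃ r : ℝ, 0 ≤ r ∧ f 1 = r :=
    ⟨(f 1).re, (Complex.le_def.mp hone).1,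
      Complex.ext rfl (by simpa using (Complex.le_def.mp hone).2.symm)⟩
  rw [hr', Complex.le_def] at h₁ h₂
  simp at h₁ h₂
  have : f a = ((f a).re : ℂ) := Complex.ext rfl (by simpa using h₂.2.symm)
  rw [hr', this, Complex.norm_real, Complex.norm_real, Real.norm_of_nonneg hr, Real.norm_eq_abs,
    abs_le]
  constructor <;> linarith [h₁.1, h₂.1]

/-- The factor 2 comes from adding the bounds for the real and imaginary parts. It is not sharp, but
it gives automatic continuity, so states can be built from purely algebraic data. -/
theorem norm_apply_le_of_positive (f : A →ₗ[ℂ] ℂ) (hf : ∀ a, 0 ≤ f (star a * a)) (a : A) :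
    ‖f a‖ ≤ 2 * ‖f 1‖ * ‖a‖ := by
  have h₁ := norm_apply_le_of_positive_of_isSelfAdjoint f hf (ℜ a).2
  have h₂ := norm_apply_le_of_positive_of_isSelfAdjoint f hf (ℑ a).2
  have h₃ : ‖((ℜ a : selfAdjoint A) : A)‖ ≤ ‖a‖ := realPart.norm_le a
  have h₄ : ‖((ℑ a : selfAdjoint A) : A)‖ ≤ ‖a‖ := imaginaryPart.norm_le a
  calc ‖f a‖ = ‖f (ℜ a) + Complex.I * f (ℑ a)‖ := by
        conv_lhs => rw [← realPart_add_I_smul_imaginaryPart a, map_add, map_smul, smul_eq_mul]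
    _ ≤ ‖f (ℜ a)‖ + ‖f (ℑ a)‖ := (norm_add_le _ _).trans (by simp)
    _ ≤ ‖a‖ * ‖f 1‖ + ‖a‖ * ‖f 1‖ := by
        gcongr
        · exact h₁.trans (by gcongr)
        · exact h₂.trans (by gcongr)
    _ = 2 * ‖f 1‖ * ‖a‖ := by ring

/-- The state given by a positive linear functional which maps `1` to `1`. -/
def StateSpace.ofPositive (f : A →ₗ[ℂ] ℂ) (h1 : f 1 = 1) (hf : ∀ a, 0 ≤ f (star a * a)) :
    StateSpace A :=
  ⟨StrongDual.toWeakDual (f.mkContinuous (2 * ‖f 1‖) (norm_apply_le_of_positive f hf)), h1, hf⟩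

@[simp] theorem StateSpace.ofPositive_apply (f : A →ₗ[ℂ] ℂ) (h1 : f 1 = 1)
    (hf : ∀ a, 0 ≤ f (star a * a)) (a : A) : (StateSpace.ofPositive f h1 hf).1 a = f a := rfl

@[simp] theorem StateSpace.pullback_apply {B : Type*} [CStarAlgebra B] (π : A →⋆ₐ[ℂ] B)
    (φ : StateSpace B) (a : A) : (StateSpace.pullback π φ).1 a = φ.1 (π a) := rfl

theorem StateSpace.norm_apply_le (φ : StateSpace A) (a : A) : ‖φ.1 a‖ ≤ 2 * ‖a‖ := by
  have := norm_apply_le_of_positive (φ.1 : A →L[ℂ] ℂ).toLinearMap φ.2.2 a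
  change ‖φ.1 a‖ ≤ 2 * ‖φ.1 1‖ * ‖a‖ at this
  simpa [φ.2.1] using this

theorem StateSpace.norm_apply_le_of_isSelfAdjoint (φ : StateSpace A) {a : A}
    (ha : IsSelfAdjoint a) : ‖φ.1 a‖ ≤ ‖a‖ := by
  have := norm_apply_le_of_positive_of_isSelfAdjoint (φ.1 : A →L[ℂ] ℂ).toLinearMap φ.2.2 ha
  change ‖φ.1 a‖ ≤ ‖a‖ * ‖φ.1 1‖ at this
  simpa [φ.2.1] using this

instance StateSpace.instCompactSpace : CompactSpace (StateSpace A) := by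
  refine isCompact_iff_compactSpace.mp ?_
  refine IsCompact.of_isClosed_subset (WeakDual.isCompact_closedBall (0 : StrongDual ℂ A) 2) ?_ ?_
  · have : {φ : WeakDual ℂ A | φ 1 = 1 ∧ ∀ a : A, 0 ≤ φ (star a * a)} =
        {φ | φ 1 = 1} ∩ ⋂ a : A, {φ | 0 ≤ φ (star a * a)} := by ext; simp
    change IsClosed {φ : WeakDual ℂ A | φ 1 = 1 ∧ ∀ a : A, 0 ≤ φ (star a * a)}
    rw [this]
    exact (isClosed_eq (WeakDual.eval_continuous _) continuous_const).inter
      (isClosed_iInter fun a => isClosed_le continuous_const (WeakDual.eval_continuous _))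
  · intro φ hφ
    simp only [Set.mem_preimage, Metric.mem_closedBall, dist_zero_right]
    exact ContinuousLinearMap.opNorm_le_bound _ (by norm_num) fun a =>
      StateSpace.norm_apply_le ⟨φ, hφ⟩ a

theorem StateSpace.tendsto_iff {ι : Type*} {l : Filter ι} {f : ι → StateSpace A}
    {φ : StateSpace A} :
    Tendsto f l (𝓝 φ) ↔ ∀ a : A, Tendsto (fun i => (f i).1 a) l (𝓝 (φ.1 a)) := by
  rw [tendsto_subtype_rng]
  exact tendsto_iff_forall_eval_tendsto_topDualPairing

/-- A norm-one functional which maps `1` to `1` is positive. -/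
theorem nonneg_apply_star_mul_self_of_norm_le_one (f : StrongDual ℂ A) (hf : ‖f‖ ≤ 1)
    (h1 : f 1 = 1) (a : A) : 0 ≤ f (star a * a) := by
  let _ := CStarAlgebra.spectralOrder A
  let _ := CStarAlgebra.spectralOrderedRing A
  have : Nontrivial A := ⟨1, 0, fun h => by simp [h] at h1⟩
  set x : A := star a * a with hx
  have hxsa : star x = x := by simp [hx]
  have hx0 : 0 ≤ x := star_mul_self_nonneg a
  have hle : ∀ y : A, ‖f y‖ ≤ ‖y‖ := fun y => by
    simpa using f.le_of_opNorm_le hf y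
  -- Test `f` on `x + i t 1`, whose squared norm is at most `‖x‖² + t²` because `x` is self-adjoint.
  -- The left side has a term linear in `t` unless `f x` is real.
  have him : ∀ t : ℝ, (f x).re ^ 2 + ((f x).im + t) ^ 2 ≤ ‖x‖ ^ 2 + t ^ 2 := fun t => by
    have h := hle (x + (t * Complex.I) • 1)
    have e : star (x + ((t : ℂ) * Complex.I) • (1 : A)) * (x + ((t : ℂ) * Complex.I) • 1) =
        x * x + ((t ^ 2 : ℝ) : ℂ) • (1 : A) := by
      have hI : (t : ℂ) * Complex.I * (t * Complex.I) = -(t ^ 2 : ℂ) := by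
        linear_combination (t : ℂ) ^ 2 * Complex.I_mul_I
      simp only [star_add, star_smul, hxsa, star_one, star_mul', Complex.star_def,
        Complex.conj_ofReal, Complex.conj_I, add_mul, mul_add, smul_mul_assoc, one_mul,
        mul_smul_comm, mul_one, smul_smul, neg_smul, mul_neg,
        neg_mul, smul_add, smul_neg]
      rw [hI]
      push_cast
      simp only [neg_smul, neg_neg]
      abel
    have h2 : ‖x + ((t : ℂ) * Complex.I) • (1 : A)‖ ^ 2 ≤ ‖x‖ ^ 2 + t ^ 2 := by
      rw [sq, ← CStarRing.norm_star_mul_self, e]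
      refine (norm_add_le _ _).trans ?_
      rw [norm_smul, Complex.norm_real, norm_one, mul_one, Real.norm_of_nonneg (sq_nonneg t)]
      gcongr
      rw [sq]
      exact norm_mul_le _ _
    have h3 : ‖f (x + ((t : ℂ) * Complex.I) • (1 : A))‖ ^ 2 =
        (f x).re ^ 2 + ((f x).im + t) ^ 2 := by
      rw [map_add, map_smul, h1, Complex.sq_norm, Complex.normSq_apply]
      simp
      ring
    rw [← h3]
    exact (pow_le_pow_left₀ (norm_nonneg _) h 2).trans h2
  have him0 : (f x).im = 0 := by
    by_contra hne
    -- This `t` makes the cross term `2 t Im f(x)` equal to `‖x‖² + 1`, too large for the bound.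
    have := him ((‖x‖ ^ 2 + 1) / (2 * (f x).im))
    have e : 2 * (f x).im * ((‖x‖ ^ 2 + 1) / (2 * (f x).im)) = ‖x‖ ^ 2 + 1 := by field_simp
    nlinarith [sq_nonneg (f x).re, sq_nonneg (f x).im]
  -- From `0 ≤ x ≤ ‖x‖` follows `‖‖x‖ - x‖ ≤ ‖x‖`, hence `‖x‖ - Re f(x) ≤ ‖x‖`.
  have hre : 0 ≤ (f x).re := by
    have h₁ : ‖algebraMap ℝ A ‖x‖ - x‖ ≤ ‖x‖ := by
      have h0 : 0 ≤ algebraMap ℝ A ‖x‖ - x :=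
        sub_nonneg.mpr (IsSelfAdjoint.le_algebraMap_norm_self hxsa)
      refine (CStarAlgebra.norm_le_norm_of_nonneg_of_le h0 (sub_le_self _ hx0)).trans ?_
      rw [norm_algebraMap', norm_norm]
    have h₂ := (Complex.re_le_norm _).trans ((hle _).trans h₁)
    rw [map_sub, Algebra.algebraMap_eq_smul_one, ← Complex.coe_smul, map_smul, h1] at h₂
    simp at h₂
    exact h₂
  exact Complex.le_def.mpr ⟨hre, him0.symm⟩

instance StateSpace.instNonempty [Nontrivial A] : Nonempty (StateSpace A) := by
  obtain ⟨g, hg, hg1⟩ := exists_dual_vector ℂ (1 : A) (norm_ne_zero_iff.mpr one_ne_zero)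
  have h1 : g 1 = 1 := by simpa using hg1
  exact ⟨.ofPositive g.toLinearMap h1 (nonneg_apply_star_mul_self_of_norm_le_one g hg.le h1)⟩

/-- The state `s φ + t ψ`, for `0 ≤ s, t` with `s + t = 1`. -/
def StateSpace.combo (s t : ℂ) (hs : 0 ≤ s) (ht : 0 ≤ t) (hst : s + t = 1)
    (φ ψ : StateSpace A) : StateSpace A :=
  .ofPositive (s • (φ.1 : A →L[ℂ] ℂ).toLinearMap + t • (ψ.1 : A →L[ℂ] ℂ).toLinearMap)
    (by
      change s * φ.1 1 + t * ψ.1 1 = 1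
      rw [φ.2.1, ψ.2.1, mul_one, mul_one, hst])
    (fun a => add_nonneg (mul_nonneg hs (φ.2.2 a)) (mul_nonneg ht (ψ.2.2 a)))

@[simp] theorem StateSpace.combo_apply (s t : ℂ) (hs : 0 ≤ s) (ht : 0 ≤ t) (hst : s + t = 1)
    (φ ψ : StateSpace A) (a : A) :
    (StateSpace.combo s t hs ht hst φ ψ).1 a = s * φ.1 a + t * ψ.1 a := rfl

end Positive

/-! ### Restriction of states to a corner -/

section Corner

variable {A D : Type*} [CStarAlgebra A] [CStarAlgebra D]

/-- The normalized restriction of the state `φ` along a linear map `j` with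
`j (a* a) = j (a)* j (a)`; it is `φ₀` where the restriction is zero. -/
def StateSpace.corner (j : A →ₗ[ℂ] D) (hj : ∀ a, j (star a * a) = star (j a) * j a)
    (φ₀ : StateSpace A) (φ : StateSpace D) : StateSpace A :=
  open scoped Classical in
  if h : φ.1 (j 1) = 0 then φ₀ else
    .ofPositive ((φ.1 (j 1))⁻¹ • (φ.1 : D →L[ℂ] ℂ).toLinearMap ∘ₗ j) (inv_mul_cancel₀ h)
      (fun a => by
        change 0 ≤ (φ.1 (j 1))⁻¹ * φ.1 (j (star a * a))
        have h1 : (0 : ℂ) ≤ φ.1 (j 1) := by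
          have := φ.2.2 (j 1)
          rwa [← hj, star_one, one_mul] at this
        rw [hj]
        exact mul_nonneg (inv_nonneg_of_nonneg h1) (φ.2.2 _))

theorem StateSpace.apply_map_one_nonneg (j : A →ₗ[ℂ] D)
    (hj : ∀ a, j (star a * a) = star (j a) * j a) (φ : StateSpace D) : 0 ≤ φ.1 (j 1) := by
  have := φ.2.2 (j 1)
  rwa [← hj, star_one, one_mul] at this

/-- If the weight `φ (j 1)` is zero, positivity bounds `φ ∘ j` by a multiple of it, so `φ ∘ j = 0`
and the choice of `φ₀` is immaterial. -/
theorem StateSpace.apply_corner (j : A →ₗ[ℂ] D)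
    (hj : ∀ a, j (star a * a) = star (j a) * j a) (φ₀ : StateSpace A) (φ : StateSpace D) (a : A) :
    φ.1 (j a) = φ.1 (j 1) * (StateSpace.corner j hj φ₀ φ).1 a := by
  by_cases h : φ.1 (j 1) = 0
  · have := norm_apply_le_of_positive ((φ.1 : D →L[ℂ] ℂ).toLinearMap ∘ₗ j)
      (fun a => by
        change 0 ≤ φ.1 (j (star a * a))
        rw [hj]
        exact φ.2.2 _) a
    change ‖φ.1 (j a)‖ ≤ 2 * ‖φ.1 (j 1)‖ * ‖a‖ at this
    rw [h] at this ⊢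
    simpa using this
  · rw [StateSpace.corner, dif_neg h]
    exact (mul_inv_cancel_left₀ h _).symm

theorem StateSpace.tendsto_corner (j : A →ₗ[ℂ] D)
    (hj : ∀ a, j (star a * a) = star (j a) * j a) (φ₀ : StateSpace A) {φ : StateSpace D}
    (h : φ.1 (j 1) ≠ 0) :
    Tendsto (StateSpace.corner j hj φ₀) (𝓝 φ) (𝓝 (StateSpace.corner j hj φ₀ φ)) := by
  have hev : ∀ d : D, Tendsto (fun ψ : StateSpace D => ψ.1 d) (𝓝 φ) (𝓝 (φ.1 d)) :=
    StateSpace.tendsto_iff.mp tendsto_id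
  have hne : ∀ᶠ ψ : StateSpace D in 𝓝 φ, ψ.1 (j 1) ≠ 0 := (hev _).eventually_ne h
  have hval : ∀ (ψ : StateSpace D) (a : A), ψ.1 (j 1) ≠ 0 →
      (StateSpace.corner j hj φ₀ ψ).1 a = (ψ.1 (j 1))⁻¹ * ψ.1 (j a) := fun ψ a hψ => by
    rw [StateSpace.apply_corner j hj φ₀ ψ a, inv_mul_cancel_left₀ hψ]
  refine StateSpace.tendsto_iff.mpr fun a => ?_
  rw [hval φ a h]
  refine (((hev (j 1)).inv₀ h).mul (hev (j a))).congr' ?_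
  filter_upwards [hne] with ψ hψ
  exact (hval ψ a hψ).symm

end Corner

/-! ### The Monge-Kantorovich metric and the weak* topology -/

section MongeKantorovich

variable {A : Type*} [CStarAlgebra A] {L : selfAdjoint A → ℝ≥0∞}

theorem enorm_sub_le_mkDist (φ ψ : StateSpace A) {a : selfAdjoint A} (ha : L a ≤ 1) :
    ‖φ.1 (a : A) - ψ.1 (a : A)‖ₑ ≤ mkDist L φ ψ :=
  le_iSup₂ (f := fun (a : selfAdjoint A) (_ : L a ≤ 1) => ‖φ.1 (a : A) - ψ.1 (a : A)‖ₑ) a ha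

theorem exists_eq_coe_of_ne_top {x : ℝ≥0∞} (hx : x ≠ ∞) : ∃ r : ℝ≥0, (r : ℝ≥0∞) = x :=
  ⟨x.toNNReal, ENNReal.coe_toNNReal hx⟩

theorem toNNReal_le_of_le_coe {x : ℝ≥0∞} {r : ℝ≥0} (hx : x ≤ r) : x.toNNReal ≤ r := by
  simpa using ENNReal.toNNReal_mono ENNReal.coe_ne_top hx

theorem continuous_edist_left {X : Type*} [PseudoEMetricSpace X] (x : X) :
    Continuous fun y => edist y x := by
  fun_prop

theorem tendsto_mk_iff {ι : Type*} {l : Filter ι} {f : ι → StateSpace A} {φ : StateSpace A} :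
    Tendsto f l (@nhds _ (mkEMetric L).toUniformSpace.toTopologicalSpace φ) ↔
      Tendsto (fun i => mkDist L (f i) φ) l (𝓝 0) :=
  @tendsto_iff_edist_tendsto_0 _ _ (mkEMetric L) l f φ

theorem exists_enorm_sub_le_mul_mkDist
    (hsmul : ∀ (t : ℝ) (a : selfAdjoint A), L (t • a) = ‖t‖ₑ * L a) {a : selfAdjoint A}
    (ha : L a ≠ ∞) :
    ∃ c : ℝ≥0, ∀ φ ψ : StateSpace A, ‖φ.1 (a : A) - ψ.1 (a : A)‖ₑ ≤ c * mkDist L φ ψ := by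
  obtain ⟨r, hr⟩ := exists_eq_coe_of_ne_top ha
  -- Dividing by `r + 1` instead of `r` covers `L a = 0`.
  refine ⟨r + 1, fun φ ψ => ?_⟩
  have hc : ((r + 1 : ℝ≥0) : ℝ) ≠ 0 := by positivity
  have hle : L (((r + 1 : ℝ≥0) : ℝ)⁻¹ • a) ≤ 1 := by
    rw [hsmul, ← hr, ← NNReal.coe_inv, Real.enorm_eq_ofReal (NNReal.coe_nonneg _),
      ENNReal.ofReal_coe_nnreal, ← ENNReal.coe_mul, ENNReal.coe_le_one_iff,
      inv_mul_le_iff₀ (by positivity)]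
    simp
  have h := enorm_sub_le_mkDist φ ψ hle
  have e : φ.1 (a : A) - ψ.1 (a : A) = (((r + 1 : ℝ≥0) : ℝ) : ℂ) *
      (φ.1 ((((r + 1 : ℝ≥0) : ℝ)⁻¹ • a : selfAdjoint A) : A) -
        ψ.1 ((((r + 1 : ℝ≥0) : ℝ)⁻¹ • a : selfAdjoint A) : A)) := by
    rw [selfAdjoint.val_smul, ← Complex.coe_smul, map_smul, map_smul, ← smul_sub, smul_eq_mul,
      ← mul_assoc, ← Complex.ofReal_mul, mul_inv_cancel₀ hc, Complex.ofReal_one, one_mul]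
  have h' : ‖(((r + 1 : ℝ≥0) : ℝ) : ℂ)‖ₑ = ((r + 1 : ℝ≥0) : ℝ≥0∞) := by
    rw [← ofReal_norm, Complex.norm_real, Real.norm_of_nonneg (NNReal.coe_nonneg _),
      ENNReal.ofReal_coe_nnreal]
  rw [e, enorm_mul, h']
  gcongr

/-- Convergence holds on the domain of `L`, where evaluation is Lipschitz for the metric. It extends
to `sa(A)` by density, since states are contractive there, and then to `A` through real and
imaginary parts. -/
theorem tendsto_apply_of_tendsto_mkDist
    (hsmul : ∀ (t : ℝ) (a : selfAdjoint A), L (t • a) = ‖t‖ₑ * L a)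
    (hdense : Dense {a : selfAdjoint A | L a ≠ ∞}) {ι : Type*} {l : Filter ι}
    {f : ι → StateSpace A} {φ : StateSpace A}
    (h : Tendsto (fun i => mkDist L (f i) φ) l (𝓝 0)) (a : A) :
    Tendsto (fun i => (f i).1 a) l (𝓝 (φ.1 a)) := by
  have hsa : ∀ a : selfAdjoint A,
      Tendsto (fun i => (f i).1 (a : A)) l (𝓝 (φ.1 (a : A))) := fun a => by
    refine Metric.tendsto_nhds.mpr fun δ hδ => ?_
    obtain ⟨b, hb, hab⟩ := hdense.exists_dist_lt a (ε := δ / 3) (by positivity)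
    obtain ⟨c, hc⟩ := exists_enorm_sub_le_mul_mkDist hsmul hb
    have hlim : Tendsto (fun i => (f i).1 (b : A)) l (𝓝 (φ.1 (b : A))) := by
      refine tendsto_iff_edist_tendsto_0.mpr ?_
      have h0 : Tendsto (fun i => (c : ℝ≥0∞) * mkDist L (f i) φ) l (𝓝 0) := by
        simpa using ENNReal.Tendsto.const_mul h (Or.inr ENNReal.coe_ne_top)
      refine tendsto_of_tendsto_of_tendsto_of_le_of_le tendsto_const_nhds h0
        (fun _ => zero_le) fun i => ?_
      rw [edist_eq_enorm_sub]
      exact hc _ _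
    have hst : ∀ ψ : StateSpace A, dist (ψ.1 (a : A)) (ψ.1 (b : A)) < δ / 3 := fun ψ => by
      rw [dist_eq_norm, ← map_sub]
      refine (ψ.norm_apply_le_of_isSelfAdjoint (a.2.sub b.2)).trans_lt ?_
      rwa [← dist_eq_norm]
    filter_upwards [Metric.tendsto_nhds.mp hlim (δ / 3) (by positivity)] with i hi
    have h1 := hst (f i)
    have h2 := hst φ
    rw [dist_comm] at h2
    calc dist ((f i).1 (a : A)) (φ.1 (a : A)) ≤ _ := dist_triangle4 _ _ _ _
      _ < δ / 3 + δ / 3 + δ / 3 := by gcongr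
      _ = δ := by ring
  have hd : ∀ ψ : StateSpace A, ψ.1 a = ψ.1 (ℜ a : A) + Complex.I * ψ.1 (ℑ a : A) := fun ψ => by
    conv_lhs => rw [← realPart_add_I_smul_imaginaryPart a, map_add, map_smul, smul_eq_mul]
  rw [hd φ]
  simp only [hd (f _)]
  exact (hsa _).add ((hsa _).const_mul _)

theorem mk_topology_of_tendsto
    (hsmul : ∀ (t : ℝ) (a : selfAdjoint A), L (t • a) = ‖t‖ₑ * L a)
    (hdense : Dense {a : selfAdjoint A | L a ≠ ∞})
    (h : ∀ φ : StateSpace A, Tendsto (fun ψ => mkDist L ψ φ) (𝓝 φ) (𝓝 0)) :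
    (mkEMetric L).toUniformSpace.toTopologicalSpace =
      (inferInstance : TopologicalSpace (StateSpace A)) := by
  refine TopologicalSpace.ext_nhds fun φ => le_antisymm ?_ ?_
  · refine tendsto_id'.mp (StateSpace.tendsto_iff.mpr fun a => ?_)
    exact tendsto_apply_of_tendsto_mkDist hsmul hdense (tendsto_mk_iff.mp tendsto_id) a
  · exact tendsto_id'.mp (tendsto_mk_iff.mpr (h φ))

variable {F : ℝ≥0 → ℝ≥0 → ℝ≥0 → ℝ≥0 → ℝ≥0}

theorem IsQuantumCompactMetricSpace.tendsto_mkDist (hL : IsQuantumCompactMetricSpace F L)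
    {ι : Type*} {l : Filter ι} {f : ι → StateSpace A} {φ : StateSpace A} (h : Tendsto f l (𝓝 φ)) :
    Tendsto (fun i => mkDist L (f i) φ) l (𝓝 0) := by
  refine tendsto_mk_iff.mp ?_
  rwa [hL.mk_topology]

theorem IsQuantumCompactMetricSpace.leibniz_mono (hL : IsQuantumCompactMetricSpace F L)
    (hF : IsPermissible F) {x y : selfAdjoint A} {l m p q : ℝ≥0} (hx : L x ≤ l) (hy : L y ≤ m)
    (hp : ‖(x : A)‖₊ ≤ p) (hq : ‖(y : A)‖₊ ≤ q) :
    L (ℜ ((x : A) * (y : A))) ≤ F p q l m ∧ L (ℑ ((x : A) * (y : A))) ≤ F p q l m :=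
  max_le_iff.mp ((hL.leibniz x y (ne_top_of_le_ne_top ENNReal.coe_ne_top hx)
    (ne_top_of_le_ne_top ENNReal.coe_ne_top hy)).trans (ENNReal.coe_le_coe.mpr
      (hF.mono _ _ _ _ _ _ _ _ hp hq (toNNReal_le_of_le_coe hx)
        (toNNReal_le_of_le_coe hy))))

/-- The distance to `φ` is weak* continuous because the metric induces that topology, so it attains
a finite maximum on the compact state space. -/
theorem IsQuantumCompactMetricSpace.exists_mkDist_le (hL : IsQuantumCompactMetricSpace F L)
    (φ : StateSpace A) : ∃ C : ℝ≥0, ∀ ψ : StateSpace A, mkDist L ψ φ ≤ C := by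
  have hcont : Continuous fun ψ : StateSpace A => mkDist L ψ φ := by
    have : @Continuous _ _ (mkEMetric L).toUniformSpace.toTopologicalSpace _
        fun ψ : StateSpace A => mkDist L ψ φ :=
      @continuous_edist_left _ (mkEMetric L) φ
    rwa [hL.mk_topology] at this
  obtain ⟨ψ₀, -, h⟩ := isCompact_univ.exists_isMaxOn ⟨φ, Set.mem_univ _⟩ hcont.continuousOn
  refine ⟨(mkDist L ψ₀ φ).toNNReal, fun ψ => ?_⟩
  rw [ENNReal.coe_toNNReal (hL.mk_ne_top _ _)]
  exact h (Set.mem_univ ψ)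

/-- Where the weight of `φ` is nonzero the corner is continuous at `φ`. Where it is zero the corner
may be discontinuous, but its distances are bounded and the weight factor tends to zero. -/
theorem IsQuantumCompactMetricSpace.tendsto_enorm_mul_mkDist_corner
    (hL : IsQuantumCompactMetricSpace F L) {D : Type*} [CStarAlgebra D] (j : A →ₗ[ℂ] D)
    (hj : ∀ a, j (star a * a) = star (j a) * j a) (φ₀ : StateSpace A) (φ : StateSpace D) :
    Tendsto (fun ψ : StateSpace D => ‖ψ.1 (j 1)‖ₑ *
      mkDist L (StateSpace.corner j hj φ₀ ψ) (StateSpace.corner j hj φ₀ φ)) (𝓝 φ) (𝓝 0) := by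
  have hev : Tendsto (fun ψ : StateSpace D => ‖ψ.1 (j 1)‖ₑ) (𝓝 φ) (𝓝 ‖φ.1 (j 1)‖ₑ) :=
    (StateSpace.tendsto_iff.mp tendsto_id (j 1)).enorm
  by_cases h : φ.1 (j 1) = 0
  · obtain ⟨C, hC⟩ := hL.exists_mkDist_le (StateSpace.corner j hj φ₀ φ)
    rw [h, enorm_zero] at hev
    have h0 : Tendsto (fun ψ : StateSpace D => ‖ψ.1 (j 1)‖ₑ * (C : ℝ≥0∞)) (𝓝 φ) (𝓝 0) := by
      simpa using ENNReal.Tendsto.mul_const hev (Or.inr ENNReal.coe_ne_top)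
    refine tendsto_of_tendsto_of_tendsto_of_le_of_le tendsto_const_nhds h0
      (fun _ => zero_le) fun ψ => ?_
    dsimp only
    gcongr
    exact hC _
  · have := ENNReal.Tendsto.mul hev (Or.inr ENNReal.zero_ne_top)
      (hL.tendsto_mkDist (StateSpace.tendsto_corner j hj φ₀ h)) (Or.inr enorm_ne_top)
    simpa using this

end MongeKantorovich

/-! ### The direct sum of two quantum compact metric spaces -/

section Sum

variable {D₁ D₂ B : Type*} [CStarAlgebra D₁] [CStarAlgebra D₂] [CStarAlgebra B]

theorem prod_nnnorm_fst_le (x : D₁ × D₂) : ‖x.1‖₊ ≤ ‖x‖₊ := norm_fst_le x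

theorem prod_nnnorm_snd_le (x : D₁ × D₂) : ‖x.2‖₊ ≤ ‖x‖₊ := norm_snd_le x

theorem coe_saMap (π : D₁ →⋆ₐ[ℂ] B) (a : selfAdjoint D₁) : (saMap π a : B) = π a := rfl

theorem saMap_add (π : D₁ →⋆ₐ[ℂ] B) (a b : selfAdjoint D₁) :
    saMap π (a + b) = saMap π a + saMap π b := Subtype.ext (map_add π (a : D₁) b)

theorem saMap_smul (π : D₁ →⋆ₐ[ℂ] B) (t : ℝ) (a : selfAdjoint D₁) :
    saMap π (t • a) = t • saMap π a := by
  refine Subtype.ext ?_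
  rw [coe_saMap, selfAdjoint.val_smul, selfAdjoint.val_smul, ← Complex.coe_smul, map_smul,
    Complex.coe_smul, coe_saMap]

theorem saMap_realPart (π : D₁ →⋆ₐ[ℂ] B) (a : D₁) : saMap π (ℜ a) = ℜ (π a) := by
  refine Subtype.ext ?_
  rw [coe_saMap, realPart_apply_coe, realPart_apply_coe, ← Complex.coe_smul, map_smul, map_add,
    map_star, Complex.coe_smul]

theorem saMap_imaginaryPart (π : D₁ →⋆ₐ[ℂ] B) (a : D₁) : saMap π (ℑ a) = ℑ (π a) := by
  refine Subtype.ext ?_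
  rw [coe_saMap, imaginaryPart_apply_coe, imaginaryPart_apply_coe, map_smul, ← Complex.coe_smul,
    map_smul, map_sub, map_star, Complex.coe_smul]

theorem continuous_saMap (π : D₁ →⋆ₐ[ℂ] B) : Continuous (saMap π) :=
  ((map_continuous π).comp continuous_subtype_val).subtype_mk _

/-- The self-adjoint element `(a, b)` of a product. -/
def saPair (a : selfAdjoint D₁) (b : selfAdjoint D₂) : selfAdjoint (D₁ × D₂) :=
  ⟨(a, b), Prod.ext a.2 b.2⟩

@[simp] theorem saMap_fst_saPair (a : selfAdjoint D₁) (b : selfAdjoint D₂) :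
    saMap (StarAlgHom.fst ℂ D₁ D₂) (saPair a b) = a := rfl

@[simp] theorem saMap_snd_saPair (a : selfAdjoint D₁) (b : selfAdjoint D₂) :
    saMap (StarAlgHom.snd ℂ D₁ D₂) (saPair a b) = b := rfl

theorem continuous_saPair :
    Continuous fun p : selfAdjoint D₁ × selfAdjoint D₂ => saPair p.1 p.2 :=
  ((continuous_subtype_val.comp continuous_fst).prodMk
    (continuous_subtype_val.comp continuous_snd)).subtype_mk _

theorem surjective_saPair :
    Function.Surjective fun p : selfAdjoint D₁ × selfAdjoint D₂ => saPair p.1 p.2 := fun d =>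
  ⟨(saMap (StarAlgHom.fst ℂ D₁ D₂) d, saMap (StarAlgHom.snd ℂ D₁ D₂) d), rfl⟩

theorem inl_star_mul_self (a : D₁) : LinearMap.inl ℂ D₁ D₂ (star a * a) =
    star (LinearMap.inl ℂ D₁ D₂ a) * LinearMap.inl ℂ D₁ D₂ a := by
  ext <;> simp

theorem inr_star_mul_self (a : D₂) : LinearMap.inr ℂ D₁ D₂ (star a * a) =
    star (LinearMap.inr ℂ D₁ D₂ a) * LinearMap.inr ℂ D₁ D₂ a := by
  ext <;> simp

theorem StateSpace.apply_inl_one_add_apply_inr_one (φ : StateSpace (D₁ × D₂)) :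
    φ.1 (LinearMap.inl ℂ D₁ D₂ 1) + φ.1 (LinearMap.inr ℂ D₁ D₂ 1) = 1 := by
  rw [← map_add]
  refine (congrArg φ.1 ?_).trans φ.2.1
  ext <;> simp

theorem StateSpace.apply_eq_corner_add_corner (φ₁ : StateSpace D₁) (φ₂ : StateSpace D₂)
    (φ : StateSpace (D₁ × D₂)) (d : D₁ × D₂) :
    φ.1 d = φ.1 (LinearMap.inl ℂ D₁ D₂ 1) *
        (StateSpace.corner (LinearMap.inl ℂ D₁ D₂) inl_star_mul_self φ₁ φ).1 d.1 +
      φ.1 (LinearMap.inr ℂ D₁ D₂ 1) *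
        (StateSpace.corner (LinearMap.inr ℂ D₁ D₂) inr_star_mul_self φ₂ φ).1 d.2 := by
  rw [← StateSpace.apply_corner, ← StateSpace.apply_corner, ← map_add]
  congr 1
  ext <;> simp

variable {L₁ : selfAdjoint D₁ → ℝ≥0∞} {L₂ : selfAdjoint D₂ → ℝ≥0∞} {θ : D₁ →⋆ₐ[ℂ] B}
  {π : D₂ →⋆ₐ[ℂ] B} {ε : ℝ}

theorem ofReal_inv_mul_norm_le_iff {E : Type*} [NormedAddCommGroup E] (hε : 0 < ε) (x : E)
    (r : ℝ≥0) : ENNReal.ofReal (1 / ε * ‖x‖) ≤ r ↔ ‖x‖ ≤ ε * r := by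
  rw [ENNReal.ofReal_le_coe, one_div, inv_mul_le_iff₀ hε]

theorem sumL_le_coe_iff (hε : 0 < ε) (d : selfAdjoint (D₁ × D₂)) (r : ℝ≥0) :
    sumL L₁ L₂ θ π ε d ≤ r ↔ L₁ (saMap (StarAlgHom.fst ℂ D₁ D₂) d) ≤ r ∧
      L₂ (saMap (StarAlgHom.snd ℂ D₁ D₂) d) ≤ r ∧
      ‖θ (d : D₁ × D₂).1 - π (d : D₁ × D₂).2‖ ≤ ε * r := by
  rw [sumL, max_le_iff, max_le_iff, ofReal_inv_mul_norm_le_iff hε, and_assoc]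

theorem sumL_le_one_iff (hε : 0 < ε) (d : selfAdjoint (D₁ × D₂)) :
    sumL L₁ L₂ θ π ε d ≤ 1 ↔ L₁ (saMap (StarAlgHom.fst ℂ D₁ D₂) d) ≤ 1 ∧
      L₂ (saMap (StarAlgHom.snd ℂ D₁ D₂) d) ≤ 1 ∧
      ‖θ (d : D₁ × D₂).1 - π (d : D₁ × D₂).2‖ ≤ ε := by
  simpa using sumL_le_coe_iff (L₁ := L₁) (L₂ := L₂) (θ := θ) (π := π) hε d 1

theorem sumL_ne_top_iff (d : selfAdjoint (D₁ × D₂)) :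
    sumL L₁ L₂ θ π ε d ≠ ∞ ↔ L₁ (saMap (StarAlgHom.fst ℂ D₁ D₂) d) ≠ ∞ ∧
      L₂ (saMap (StarAlgHom.snd ℂ D₁ D₂) d) ≠ ∞ := by
  simp [sumL, ← lt_top_iff_ne_top]

theorem StateSpace.enorm_apply_sub_apply_le (μ : StateSpace B) {a b : B}
    (ha : IsSelfAdjoint a) (hb : IsSelfAdjoint b) (h : ‖a - b‖ ≤ ε) :
    ‖μ.1 a - μ.1 b‖ₑ ≤ ENNReal.ofReal ε := by
  rw [← map_sub, ← ofReal_norm]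
  exact ENNReal.ofReal_le_ofReal ((μ.norm_apply_le_of_isSelfAdjoint (ha.sub hb)).trans h)

/-- Since both pairs of weights sum to 1, `t - t' = -(s - s')`, so the change of weights contributes
`(s - s') (ψ₁ - ψ₂)`. This is split along `ψ₁`, `μ ∘ θ`, `μ ∘ π`, `ψ₂`. -/
theorem mkDist_sumL_le (hε : 0 < ε) {φ ψ : StateSpace (D₁ × D₂)} {φ₁ ψ₁ : StateSpace D₁}
    {φ₂ ψ₂ : StateSpace D₂} {s t s' t' : ℂ} (hφ : ∀ d, φ.1 d = s * φ₁.1 d.1 + t * φ₂.1 d.2)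
    (hψ : ∀ d, ψ.1 d = s' * ψ₁.1 d.1 + t' * ψ₂.1 d.2) (hst : s + t = 1) (hst' : s' + t' = 1)
    (μ : StateSpace B) :
    mkDist (sumL L₁ L₂ θ π ε) φ ψ ≤ ‖s‖ₑ * mkDist L₁ φ₁ ψ₁ + ‖t‖ₑ * mkDist L₂ φ₂ ψ₂ +
      ‖s - s'‖ₑ * (mkDist L₁ ψ₁ (.pullback θ μ) + ENNReal.ofReal ε +
        mkDist L₂ (.pullback π μ) ψ₂) := by
  refine iSup₂_le fun d hd => ?_
  obtain ⟨h₁, h₂, h₃⟩ := (sumL_le_one_iff hε d).mp hd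
  obtain ⟨⟨d₁, d₂⟩, rfl⟩ := surjective_saPair d
  change L₁ d₁ ≤ 1 at h₁
  change L₂ d₂ ≤ 1 at h₂
  change ‖θ d₁ - π d₂‖ ≤ ε at h₃
  change ‖φ.1 ((d₁ : D₁), (d₂ : D₂)) - ψ.1 ((d₁ : D₁), (d₂ : D₂))‖ₑ ≤ _
  have e : φ.1 ((d₁ : D₁), (d₂ : D₂)) - ψ.1 ((d₁ : D₁), (d₂ : D₂)) =
      s * (φ₁.1 (d₁ : D₁) - ψ₁.1 (d₁ : D₁)) + t * (φ₂.1 (d₂ : D₂) - ψ₂.1 (d₂ : D₂)) +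
      (s - s') * ((ψ₁.1 (d₁ : D₁) - μ.1 (θ d₁)) + (μ.1 (θ d₁) - μ.1 (π d₂)) +
        (μ.1 (π d₂) - ψ₂.1 (d₂ : D₂))) := by
    rw [hφ, hψ, eq_sub_of_add_eq' hst, eq_sub_of_add_eq' hst']
    ring
  rw [e]
  refine (enorm_add_le _ _).trans (add_le_add ((enorm_add_le _ _).trans (add_le_add ?_ ?_)) ?_)
  · rw [enorm_mul]
    gcongr
    exact enorm_sub_le_mkDist _ _ h₁
  · rw [enorm_mul]
    gcongr
    exact enorm_sub_le_mkDist _ _ h₂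
  · rw [enorm_mul]
    gcongr
    refine (enorm_add_le _ _).trans (add_le_add ((enorm_add_le _ _).trans (add_le_add ?_ ?_)) ?_)
    · exact enorm_sub_le_mkDist ψ₁ (.pullback θ μ) h₁
    · exact μ.enorm_apply_sub_apply_le (saMap θ d₁).2 (saMap π d₂).2 h₃
    · exact enorm_sub_le_mkDist (.pullback π μ) ψ₂ h₂

theorem norm_sub_le_of_mul_sub_mul {x x' y y' : B} {p q l m : ℝ} (hx : ‖x - x'‖ ≤ ε * l)
    (hy : ‖y - y'‖ ≤ ε * m) (hp : ‖x'‖ ≤ p) (hq : ‖y‖ ≤ q) (hε : 0 < ε) (hl : 0 ≤ l) :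
    ‖x * y - x' * y'‖ ≤ ε * (p * m + q * l) := by
  have hp0 := (norm_nonneg _).trans hp
  have e : x * y - x' * y' = (x - x') * y + x' * (y - y') := by noncomm_ring
  rw [e]
  calc _ ≤ ‖x - x'‖ * ‖y‖ + ‖x'‖ * ‖y - y'‖ :=
        (norm_add_le _ _).trans (add_le_add (norm_mul_le _ _) (norm_mul_le _ _))
    _ ≤ (ε * l) * q + p * (ε * m) := by gcongr
    _ = ε * (p * m + q * l) := by ring

theorem norm_realPart_sub_le (x y : B) : ‖((ℜ x : selfAdjoint B) : B) - (ℜ y : B)‖ ≤ ‖x - y‖ := by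
  rw [← AddSubgroupClass.coe_sub, ← map_sub]
  exact realPart.norm_le (x - y)

theorem norm_imaginaryPart_sub_le (x y : B) :
    ‖((ℑ x : selfAdjoint B) : B) - (ℑ y : B)‖ ≤ ‖x - y‖ := by
  rw [← AddSubgroupClass.coe_sub, ← map_sub]
  exact imaginaryPart.norm_le (x - y)

variable {F : ℝ≥0 → ℝ≥0 → ℝ≥0 → ℝ≥0 → ℝ≥0}

/-- The norm and seminorm of each component are at most those of the pair, so monotonicity of `F`
handles the first two terms of the maximum. The lower bound on `F` handles the bridge term. -/
theorem sumL_leibniz (hF : IsPermissible F) (h₁ : IsQuantumCompactMetricSpace F L₁)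
    (h₂ : IsQuantumCompactMetricSpace F L₂) (hε : 0 < ε) (a b : selfAdjoint (D₁ × D₂))
    (ha : sumL L₁ L₂ θ π ε a ≠ ∞) (hb : sumL L₁ L₂ θ π ε b ≠ ∞) :
    max (sumL L₁ L₂ θ π ε (ℜ ((a : D₁ × D₂) * (b : D₁ × D₂))))
      (sumL L₁ L₂ θ π ε (ℑ ((a : D₁ × D₂) * (b : D₁ × D₂)))) ≤
      (F ‖(a : D₁ × D₂)‖₊ ‖(b : D₁ × D₂)‖₊ (sumL L₁ L₂ θ π ε a).toNNReal
        (sumL L₁ L₂ θ π ε b).toNNReal : ℝ≥0∞) := by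
  obtain ⟨l, hl⟩ := exists_eq_coe_of_ne_top ha
  obtain ⟨m, hm⟩ := exists_eq_coe_of_ne_top hb
  rw [← hl, ← hm, ENNReal.toNNReal_coe, ENNReal.toNNReal_coe]
  obtain ⟨ha₁, ha₂, ha₃⟩ := (sumL_le_coe_iff hε a l).mp hl.ge
  obtain ⟨hb₁, hb₂, hb₃⟩ := (sumL_le_coe_iff hε b m).mp hm.ge
  obtain ⟨⟨a₁, a₂⟩, rfl⟩ := surjective_saPair a
  obtain ⟨⟨b₁, b₂⟩, rfl⟩ := surjective_saPair b
  change L₁ a₁ ≤ l at ha₁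
  change L₂ a₂ ≤ l at ha₂
  change ‖θ a₁ - π a₂‖ ≤ ε * l at ha₃
  change L₁ b₁ ≤ m at hb₁
  change L₂ b₂ ≤ m at hb₂
  change ‖θ b₁ - π b₂‖ ≤ ε * m at hb₃
  have hbd : ∀ {r : ℝ},
      r ≤ ε * (‖((a₁ : D₁), (a₂ : D₂))‖₊ * m + ‖((b₁ : D₁), (b₂ : D₂))‖₊ * l : ℝ≥0) →
      r ≤ ε * (F ‖((a₁ : D₁), (a₂ : D₂))‖₊ ‖((b₁ : D₁), (b₂ : D₂))‖₊ l m) := fun h =>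
    h.trans (mul_le_mul_of_nonneg_left (NNReal.coe_le_coe.mpr (hF.bound _ _ _ _)) hε.le)
  have hnorm : ‖θ (a₁ * b₁ : D₁) - π (a₂ * b₂ : D₂)‖ ≤
      ε * (‖((a₁ : D₁), (a₂ : D₂))‖₊ * m + ‖((b₁ : D₁), (b₂ : D₂))‖₊ * l : ℝ≥0) := by
    rw [map_mul, map_mul]
    push_cast
    exact norm_sub_le_of_mul_sub_mul ha₃ hb₃
      ((NonUnitalStarAlgHom.norm_apply_le π _).trans (norm_snd_le ((a₁ : D₁), (a₂ : D₂))))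
      ((NonUnitalStarAlgHom.norm_apply_le θ _).trans (norm_fst_le ((b₁ : D₁), (b₂ : D₂))))
      hε l.2
  obtain ⟨hr₁, hi₁⟩ := h₁.leibniz_mono hF ha₁ hb₁ (prod_nnnorm_fst_le ((a₁ : D₁), (a₂ : D₂)))
    (prod_nnnorm_fst_le ((b₁ : D₁), (b₂ : D₂)))
  obtain ⟨hr₂, hi₂⟩ := h₂.leibniz_mono hF ha₂ hb₂ (prod_nnnorm_snd_le ((a₁ : D₁), (a₂ : D₂)))
    (prod_nnnorm_snd_le ((b₁ : D₁), (b₂ : D₂)))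
  refine max_le ((sumL_le_coe_iff hε _ _).mpr ⟨?_, ?_, ?_⟩)
    ((sumL_le_coe_iff hε _ _).mpr ⟨?_, ?_, ?_⟩)
  · rw [saMap_realPart]
    exact hr₁
  · rw [saMap_realPart]
    exact hr₂
  -- The bridge term is written with composite *-morphisms so that `ℜ` can be moved past them.
  · change ‖((saMap (θ.comp (StarAlgHom.fst ℂ D₁ D₂)) (ℜ _) : selfAdjoint B) : B) -
      (saMap (π.comp (StarAlgHom.snd ℂ D₁ D₂)) (ℜ _) : selfAdjoint B)‖ ≤ _
    rw [saMap_realPart, saMap_realPart]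
    exact hbd ((norm_realPart_sub_le _ _).trans hnorm)
  · rw [saMap_imaginaryPart]
    exact hi₁
  · rw [saMap_imaginaryPart]
    exact hi₂
  · change ‖((saMap (θ.comp (StarAlgHom.fst ℂ D₁ D₂)) (ℑ _) : selfAdjoint B) : B) -
      (saMap (π.comp (StarAlgHom.snd ℂ D₁ D₂)) (ℑ _) : selfAdjoint B)‖ ≤ _
    rw [saMap_imaginaryPart, saMap_imaginaryPart]
    exact hbd ((norm_imaginaryPart_sub_le _ _).trans hnorm)

theorem dense_sumL_ne_top (h₁ : Dense {a : selfAdjoint D₁ | L₁ a ≠ ∞})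
    (h₂ : Dense {a : selfAdjoint D₂ | L₂ a ≠ ∞}) :
    Dense {d : selfAdjoint (D₁ × D₂) | sumL L₁ L₂ θ π ε d ≠ ∞} := by
  refine (surjective_saPair.denseRange.dense_image continuous_saPair (h₁.prod h₂)).mono ?_
  rintro _ ⟨⟨a, b⟩, ⟨ha, hb⟩, rfl⟩
  exact (sumL_ne_top_iff _).mpr ⟨ha, hb⟩

theorem sumL_smul (h₁ : ∀ (t : ℝ) (a : selfAdjoint D₁), L₁ (t • a) = ‖t‖ₑ * L₁ a)
    (h₂ : ∀ (t : ℝ) (a : selfAdjoint D₂), L₂ (t • a) = ‖t‖ₑ * L₂ a) (t : ℝ)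
    (d : selfAdjoint (D₁ × D₂)) : sumL L₁ L₂ θ π ε (t • d) = ‖t‖ₑ * sumL L₁ L₂ θ π ε d := by
  obtain ⟨⟨a, b⟩, rfl⟩ := surjective_saPair d
  have e : ‖θ (saMap (StarAlgHom.fst ℂ D₁ D₂) (t • saPair a b) : D₁) -
      π (saMap (StarAlgHom.snd ℂ D₁ D₂) (t • saPair a b) : D₂)‖ = |t| * ‖θ a - π b‖ := by
    rw [saMap_smul, saMap_smul, saMap_fst_saPair, saMap_snd_saPair, ← coe_saMap θ,
      ← coe_saMap π, saMap_smul, saMap_smul, selfAdjoint.val_smul, selfAdjoint.val_smul,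
      ← smul_sub, norm_smul, Real.norm_eq_abs, coe_saMap, coe_saMap]
  change max (max (L₁ (saMap _ _)) (L₂ (saMap _ _))) (ENNReal.ofReal (1 / ε * ‖θ (saMap
    (StarAlgHom.fst ℂ D₁ D₂) (t • saPair a b) : D₁) - π (saMap (StarAlgHom.snd ℂ D₁ D₂)
    (t • saPair a b) : D₂)‖)) = ‖t‖ₑ * max (max (L₁ a) (L₂ b)) (ENNReal.ofReal
    (1 / ε * ‖θ a - π b‖))
  rw [e, saMap_smul, saMap_smul, saMap_fst_saPair, saMap_snd_saPair, h₁, h₂, mul_max, mul_max,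
    mul_left_comm, ENNReal.ofReal_mul (abs_nonneg t), ← Real.enorm_eq_ofReal_abs]

theorem sumL_add_le (h₁ : ∀ a b : selfAdjoint D₁, L₁ (a + b) ≤ L₁ a + L₁ b)
    (h₂ : ∀ a b : selfAdjoint D₂, L₂ (a + b) ≤ L₂ a + L₂ b) (hε : 0 < ε)
    (a b : selfAdjoint (D₁ × D₂)) :
    sumL L₁ L₂ θ π ε (a + b) ≤ sumL L₁ L₂ θ π ε a + sumL L₁ L₂ θ π ε b := by
  refine max_le (max_le ?_ ?_) ?_
  · rw [saMap_add]
    exact (h₁ _ _).trans (add_le_add ((le_max_left _ _).trans (le_max_left _ _))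
      ((le_max_left _ _).trans (le_max_left _ _)))
  · rw [saMap_add]
    exact (h₂ _ _).trans (add_le_add ((le_max_right _ _).trans (le_max_left _ _))
      ((le_max_right _ _).trans (le_max_left _ _)))
  · refine le_trans ?_ (add_le_add (le_max_right _ _) (le_max_right _ _))
    rw [← ENNReal.ofReal_add (by positivity) (by positivity), ← mul_add]
    refine ENNReal.ofReal_le_ofReal (mul_le_mul_of_nonneg_left ?_ (by positivity))
    have e : θ ((a + b : selfAdjoint (D₁ × D₂)) : D₁ × D₂).1 -
        π ((a + b : selfAdjoint (D₁ × D₂)) : D₁ × D₂).2 =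
        (θ (a : D₁ × D₂).1 - π (a : D₁ × D₂).2) + (θ (b : D₁ × D₂).1 - π (b : D₁ × D₂).2) := by
      rw [AddSubgroup.coe_add, Prod.fst_add, Prod.snd_add, map_add, map_add]
      abel
    rw [e]
    exact norm_add_le _ _

theorem lowerSemicontinuous_sumL (h₁ : LowerSemicontinuous L₁) (h₂ : LowerSemicontinuous L₂) :
    LowerSemicontinuous (sumL L₁ L₂ θ π ε) := by
  refine ((h₁.comp (continuous_saMap _)).sup (h₂.comp (continuous_saMap _))).sup ?_
  refine Continuous.lowerSemicontinuous ?_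
  have hθ : Continuous θ := map_continuous θ
  have hπ : Continuous π := map_continuous π
  refine ENNReal.continuous_ofReal.comp ?_
  fun_prop

theorem sumL_ker [Nontrivial B]
    (h₁ : {a : selfAdjoint D₁ | L₁ a = 0} = Set.range fun t : ℝ => t • (1 : selfAdjoint D₁))
    (h₂ : {a : selfAdjoint D₂ | L₂ a = 0} = Set.range fun t : ℝ => t • (1 : selfAdjoint D₂))
    (hε : 0 < ε) : {d : selfAdjoint (D₁ × D₂) | sumL L₁ L₂ θ π ε d = 0} =
      Set.range fun t : ℝ => t • (1 : selfAdjoint (D₁ × D₂)) := by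
  ext d
  have hθ : ∀ s : ℝ, θ (s • (1 : D₁)) = s • 1 := fun s => by
    rw [← Complex.coe_smul, map_smul, map_one, Complex.coe_smul]
  have hπ : ∀ s : ℝ, π (s • (1 : D₂)) = s • 1 := fun s => by
    rw [← Complex.coe_smul, map_smul, map_one, Complex.coe_smul]
  have key := sumL_le_coe_iff (L₁ := L₁) (L₂ := L₂) (θ := θ) (π := π) hε d 0
  simp only [ENNReal.coe_zero, nonpos_iff_eq_zero, NNReal.coe_zero, mul_zero,
    norm_le_zero_iff, sub_eq_zero] at key
  rw [Set.mem_ofPred_eq, key]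
  constructor
  · rintro ⟨e₁, e₂, e₃⟩
    obtain ⟨s, hs₁⟩ := h₁.subset e₁
    obtain ⟨t, ht₁⟩ := h₂.subset e₂
    obtain ⟨⟨a, b⟩, rfl⟩ := surjective_saPair d
    dsimp only [saMap_fst_saPair, saMap_snd_saPair] at hs₁ ht₁
    subst hs₁ ht₁
    change θ (s • (1 : D₁)) = π (t • (1 : D₂)) at e₃
    rw [hθ, hπ] at e₃
    -- The two scalars are tied together only by the bridge term, through `1 ≠ 0` in `B`.
    have hst : s = t := smul_left_injective ℝ (one_ne_zero (α := B)) e₃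
    exact ⟨s, by rw [← hst]; rfl⟩
  · rintro ⟨s, rfl⟩
    refine ⟨h₁.superset ⟨s, rfl⟩, h₂.superset ⟨s, rfl⟩, ?_⟩
    change θ (s • (1 : D₁)) = π (s • (1 : D₂))
    rw [hθ, hπ]

theorem isQuantumCompactMetricSpace_sumL (hF : IsPermissible F) [Nontrivial B]
    (h₁ : IsQuantumCompactMetricSpace F L₁) (h₂ : IsQuantumCompactMetricSpace F L₂)
    (hε : 0 < ε) : IsQuantumCompactMetricSpace F (sumL L₁ L₂ θ π ε) := by
  obtain ⟨μ⟩ := StateSpace.instNonempty (A := B)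
  let N₁ := StateSpace.corner (LinearMap.inl ℂ D₁ D₂) inl_star_mul_self (.pullback θ μ)
  let N₂ := StateSpace.corner (LinearMap.inr ℂ D₁ D₂) inr_star_mul_self (.pullback π μ)
  -- The weights of the first two terms are those of the moving state `ψ`, and the bracket in the
  -- third depends on `φ` alone. All three terms therefore tend to zero as `ψ` tends to `φ`.
  have hle : ∀ ψ φ : StateSpace (D₁ × D₂), mkDist (sumL L₁ L₂ θ π ε) ψ φ ≤
      ‖ψ.1 (LinearMap.inl ℂ D₁ D₂ 1)‖ₑ * mkDist L₁ (N₁ ψ) (N₁ φ) +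
      ‖ψ.1 (LinearMap.inr ℂ D₁ D₂ 1)‖ₑ * mkDist L₂ (N₂ ψ) (N₂ φ) +
      ‖ψ.1 (LinearMap.inl ℂ D₁ D₂ 1) - φ.1 (LinearMap.inl ℂ D₁ D₂ 1)‖ₑ *
        (mkDist L₁ (N₁ φ) (.pullback θ μ) + ENNReal.ofReal ε +
          mkDist L₂ (.pullback π μ) (N₂ φ)) := fun ψ φ =>
    mkDist_sumL_le hε (StateSpace.apply_eq_corner_add_corner _ _ ψ)
      (StateSpace.apply_eq_corner_add_corner _ _ φ)
      ψ.apply_inl_one_add_apply_inr_one φ.apply_inl_one_add_apply_inr_one μ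
  have hC : ∀ φ, mkDist L₁ (N₁ φ) (.pullback θ μ) + ENNReal.ofReal ε +
      mkDist L₂ (.pullback π μ) (N₂ φ) ≠ ∞ := fun φ =>
    ENNReal.add_ne_top.mpr ⟨ENNReal.add_ne_top.mpr ⟨h₁.mk_ne_top _ _, ENNReal.ofReal_ne_top⟩,
      h₂.mk_ne_top _ _⟩
  have hsmul := sumL_smul (θ := θ) (π := π) (ε := ε) h₁.smul h₂.smul
  have hdense := dense_sumL_ne_top (θ := θ) (π := π) (ε := ε) h₁.dense_dom h₂.dense_dom
  refine
    { nontrivial := have := h₁.nontrivial; have := h₂.nontrivial; inferInstance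
      add_le := sumL_add_le h₁.add_le h₂.add_le hε
      smul := hsmul
      dense_dom := hdense
      ker := sumL_ker h₁.ker h₂.ker hε
      mk_ne_top := fun ψ φ => ne_top_of_le_ne_top ?_ (hle ψ φ)
      mk_topology := mk_topology_of_tendsto hsmul hdense fun φ => ?_
      lsc := lowerSemicontinuous_sumL h₁.lsc h₂.lsc
      leibniz := sumL_leibniz hF h₁ h₂ hε }
  · exact ENNReal.add_ne_top.mpr ⟨ENNReal.add_ne_top.mpr
      ⟨ENNReal.mul_ne_top enorm_ne_top (h₁.mk_ne_top _ _),
        ENNReal.mul_ne_top enorm_ne_top (h₂.mk_ne_top _ _)⟩,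
      ENNReal.mul_ne_top enorm_ne_top (hC φ)⟩
  · have hev := (StateSpace.tendsto_iff (l := 𝓝 φ)).mp tendsto_id (LinearMap.inl ℂ D₁ D₂ 1)
    have h₃ : Tendsto (fun ψ : StateSpace (D₁ × D₂) =>
        ‖ψ.1 (LinearMap.inl ℂ D₁ D₂ 1) - φ.1 (LinearMap.inl ℂ D₁ D₂ 1)‖ₑ *
        (mkDist L₁ (N₁ φ) (.pullback θ μ) + ENNReal.ofReal ε +
          mkDist L₂ (.pullback π μ) (N₂ φ))) (𝓝 φ) (𝓝 0) := by
      have := ENNReal.Tendsto.mul_const (hev.sub_const (φ.1 (LinearMap.inl ℂ D₁ D₂ 1))).enorm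
        (Or.inr (hC φ))
      simpa using this
    have h₀ := ((h₁.tendsto_enorm_mul_mkDist_corner (LinearMap.inl ℂ D₁ D₂) inl_star_mul_self
      (.pullback θ μ) φ).add (h₂.tendsto_enorm_mul_mkDist_corner (LinearMap.inr ℂ D₁ D₂)
      inr_star_mul_self (.pullback π μ) φ)).add h₃
    rw [add_zero, add_zero] at h₀
    exact tendsto_of_tendsto_of_tendsto_of_le_of_le tendsto_const_nhds h₀
      (fun _ => zero_le) fun ψ => hle ψ φ

end Sum

/-! ### Quantum isometries from the direct sum -/

section SumIsometry

variable {D₁ D₂ A B E : Type*} [CStarAlgebra D₁] [CStarAlgebra D₂] [CStarAlgebra A]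
  [CStarAlgebra B] [CStarAlgebra E] {L₁ : selfAdjoint D₁ → ℝ≥0∞} {L₂ : selfAdjoint D₂ → ℝ≥0∞}
  {LA : selfAdjoint A → ℝ≥0∞} {LB : selfAdjoint B → ℝ≥0∞} {LE : selfAdjoint E → ℝ≥0∞}
  {α : D₁ →⋆ₐ[ℂ] A} {θ : D₁ →⋆ₐ[ℂ] B} {π : D₂ →⋆ₐ[ℂ] B} {β : D₂ →⋆ₐ[ℂ] E} {ε : ℝ}

theorem iInf_fiber_le {α β : Type*} {f : α → ℝ≥0∞} {g : α → β} {b : β} (a : α) (h : g a = b) :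
    ⨅ (x : α) (_ : g x = b), f x ≤ f a := iInf₂_le a h

theorem IsQuantumIsometry.le (h : IsQuantumIsometry L₁ LA α) (a : selfAdjoint D₁) :
    LA (saMap α a) ≤ L₁ a := by
  rw [h.quotient]
  exact iInf_fiber_le a rfl

theorem IsQuantumIsometry.exists_lt (h : IsQuantumIsometry L₁ LA α) {b : selfAdjoint A}
    {r : ℝ≥0∞} (hr : LA b < r) : ∃ a, saMap α a = b ∧ L₁ a < r := by
  rw [h.quotient] at hr
  simpa only [iInf_lt_iff, exists_prop] using hr

theorem sumL_saPair_le {a : selfAdjoint D₁} {b : selfAdjoint D₂} (h : saMap θ a = saMap π b)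
    {r : ℝ≥0∞} (ha : L₁ a ≤ r) (hb : L₂ b ≤ r) : sumL L₁ L₂ θ π ε (saPair a b) ≤ r := by
  refine max_le (max_le ha hb) ?_
  change ENNReal.ofReal (1 / ε * ‖(saMap θ a : B) - saMap π b‖) ≤ r
  rw [h, sub_self, norm_zero, mul_zero, ENNReal.ofReal_zero]
  exact zero_le

/-- Since `LB (θ a) ≤ L₁ a`, the element `θ a` has a lift `c` in `D₂` with `L₂ c` below any
prescribed value above `L₁ a`. The pair `(a, c)` has zero bridge term. -/
theorem isQuantumIsometry_sumL_fst (hα : IsQuantumIsometry L₁ LA α)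
    (hθ : IsQuantumIsometry L₁ LB θ) (hπ : IsQuantumIsometry L₂ LB π) :
    IsQuantumIsometry (sumL L₁ L₂ θ π ε) LA (α.comp (StarAlgHom.fst ℂ D₁ D₂)) where
  surjective := hα.surjective.comp Prod.fst_surjective
  quotient b := by
    refine le_antisymm (le_iInf₂ ?_) ?_
    · rintro d rfl
      exact (hα.le (saMap (StarAlgHom.fst ℂ D₁ D₂) d)).trans
        ((le_max_left _ _).trans (le_max_left _ _))
    · rw [hα.quotient]
      refine le_iInf₂ ?_
      rintro a rfl
      refine le_of_forall_gt fun r hr => ?_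
      -- The infimum defining `LB` need not be attained; the intermediate `q` leaves room for an
      -- approximate lift.
      obtain ⟨q, hq, hqr⟩ := exists_between hr
      obtain ⟨c, hc, hcr⟩ := hπ.exists_lt ((hθ.le a).trans_lt hq)
      refine (iInf_fiber_le (saPair a c) rfl).trans_lt ?_
      exact (sumL_saPair_le hc.symm hq.le hcr.le).trans_lt hqr

theorem isQuantumIsometry_sumL_snd (hθ : IsQuantumIsometry L₁ LB θ)
    (hπ : IsQuantumIsometry L₂ LB π) (hβ : IsQuantumIsometry L₂ LE β) :
    IsQuantumIsometry (sumL L₁ L₂ θ π ε) LE (β.comp (StarAlgHom.snd ℂ D₁ D₂)) where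
  surjective := hβ.surjective.comp Prod.snd_surjective
  quotient b := by
    refine le_antisymm (le_iInf₂ ?_) ?_
    · rintro d rfl
      exact (hβ.le (saMap (StarAlgHom.snd ℂ D₁ D₂) d)).trans
        ((le_max_right _ _).trans (le_max_left _ _))
    · rw [hβ.quotient]
      refine le_iInf₂ ?_
      rintro a rfl
      refine le_of_forall_gt fun r hr => ?_
      obtain ⟨q, hq, hqr⟩ := exists_between hr
      obtain ⟨c, hc, hcr⟩ := hθ.exists_lt ((hπ.le a).trans_lt hq)
      refine (iInf_fiber_le (saPair c a) rfl).trans_lt ?_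
      exact (sumL_saPair_le hc hcr.le hq.le).trans_lt hqr

end SumIsometry

/-! ### The extent of the direct sum -/

section Extent

variable {D D₁ D₂ A B E : Type*} [CStarAlgebra D] [CStarAlgebra D₁] [CStarAlgebra D₂]
  [CStarAlgebra A] [CStarAlgebra B] [CStarAlgebra E] {L : selfAdjoint D → ℝ≥0∞}
  {L₁ : selfAdjoint D₁ → ℝ≥0∞} {L₂ : selfAdjoint D₂ → ℝ≥0∞}
  {α : D₁ →⋆ₐ[ℂ] A} {θ : D₁ →⋆ₐ[ℂ] B} {π : D₂ →⋆ₐ[ℂ] B} {β : D₂ →⋆ₐ[ℂ] E} {ε : ℝ}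

theorem hausdorffEDist_univ_range_pullback_le {γ : D →⋆ₐ[ℂ] A} {r : ℝ≥0∞}
    (h : ∀ φ : StateSpace D, ∃ ψ : StateSpace A, mkDist L φ (.pullback γ ψ) ≤ r) :
    @Metric.hausdorffEDist (StateSpace D) (mkEMetric L) Set.univ
      (Set.range (StateSpace.pullback γ)) ≤ r := by
  refine @Metric.hausdorffEDist_le_of_mem_edist _ (mkEMetric L) _ _ _ (fun φ _ => ?_)
    fun φ _ => ⟨φ, Set.mem_univ _, ?_⟩
  · obtain ⟨ψ, hψ⟩ := h φ
    exact ⟨_, ⟨ψ, rfl⟩, hψ⟩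
  · exact ((mkEMetric L).edist_self φ).trans_le zero_le

theorem exists_mkDist_pullback_le_of_hausdorffEDist_lt {γ : D →⋆ₐ[ℂ] A} {r : ℝ≥0∞}
    (h : @Metric.hausdorffEDist (StateSpace D) (mkEMetric L) Set.univ
      (Set.range (StateSpace.pullback γ)) < r) (φ : StateSpace D) :
    ∃ ψ : StateSpace A, mkDist L φ (.pullback γ ψ) ≤ r := by
  obtain ⟨_, ⟨ψ, rfl⟩, hψ⟩ := @Metric.exists_edist_lt_of_hausdorffEDist_lt _ (mkEMetric L)
    φ _ _ _ (Set.mem_univ φ) h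
  exact ⟨ψ, hψ.le⟩

theorem enorm_add_enorm_of_nonneg {s t : ℂ} (hs : 0 ≤ s) (ht : 0 ≤ t) :
    ‖s‖ₑ + ‖t‖ₑ = ‖s + t‖ₑ := by
  rw [← ofReal_norm, ← ofReal_norm, ← ofReal_norm, ← ENNReal.ofReal_add (norm_nonneg _)
    (norm_nonneg _)]
  congr 1
  have := Complex.norm_of_nonneg' hs
  have := Complex.norm_of_nonneg' ht
  have := Complex.norm_of_nonneg' (add_nonneg hs ht)
  exact_mod_cast (by simp_all : (‖s‖ : ℂ) + ‖t‖ = ‖s + t‖)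

/-- The `φ₁` part costs `r₁`. The `φ₂` part costs `r₂` to reach `μ ∘ π`, then `ε`, then `r₁` from `μ
∘ θ`; the approximants are recombined with the same weights. The projections are arbitrary morphisms
so that the summands can be interchanged. -/
theorem exists_mkDist_pullback_comp_le {p₁ : D →⋆ₐ[ℂ] D₁} {p₂ : D →⋆ₐ[ℂ] D₂}
    (hL : ∀ d, L d ≤ 1 → L₁ (saMap p₁ d) ≤ 1 ∧ L₂ (saMap p₂ d) ≤ 1 ∧
      ‖θ (p₁ d) - π (p₂ d)‖ ≤ ε) {r₁ r₂ : ℝ≥0∞}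
    (h₁ : ∀ φ : StateSpace D₁, ∃ ψ : StateSpace A, mkDist L₁ φ (.pullback α ψ) ≤ r₁)
    (h₂ : ∀ φ : StateSpace D₂, ∃ ψ : StateSpace B, mkDist L₂ φ (.pullback π ψ) ≤ r₂)
    {s t : ℂ} (hs : 0 ≤ s) (ht : 0 ≤ t) (hst : s + t = 1) {φ : StateSpace D}
    {φ₁ : StateSpace D₁} {φ₂ : StateSpace D₂}
    (hφ : ∀ d, φ.1 d = s * φ₁.1 (p₁ d) + t * φ₂.1 (p₂ d)) :
    ∃ ψ : StateSpace A, mkDist L φ (.pullback (α.comp p₁) ψ) ≤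
      r₁ + r₂ + ENNReal.ofReal ε := by
  obtain ⟨ψ₁, hψ₁⟩ := h₁ φ₁
  obtain ⟨μ, hμ⟩ := h₂ φ₂
  obtain ⟨ψ₂, hψ₂⟩ := h₁ (.pullback θ μ)
  refine ⟨.combo s t hs ht hst ψ₁ ψ₂, iSup₂_le fun d hd => ?_⟩
  obtain ⟨k₁, k₂, k₃⟩ := hL d hd
  have e : φ.1 (d : D) - (StateSpace.pullback (α.comp p₁) (.combo s t hs ht hst ψ₁ ψ₂)).1 (d : D) =
      s * (φ₁.1 (p₁ d) - ψ₁.1 (α (p₁ d))) + t * ((μ.1 (θ (p₁ d)) - ψ₂.1 (α (p₁ d))) +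
        (φ₂.1 (p₂ d) - μ.1 (π (p₂ d))) + (μ.1 (π (p₂ d)) - μ.1 (θ (p₁ d)))) := by
    rw [hφ, StateSpace.pullback_apply, StateSpace.combo_apply, StarAlgHom.comp_apply]
    ring
  rw [e]
  have b₁ : ‖φ₁.1 (p₁ d) - ψ₁.1 (α (p₁ d))‖ₑ ≤ r₁ :=
    (enorm_sub_le_mkDist φ₁ (.pullback α ψ₁) k₁).trans hψ₁
  have b₂ : ‖μ.1 (θ (p₁ d)) - ψ₂.1 (α (p₁ d))‖ₑ ≤ r₁ :=
    (enorm_sub_le_mkDist (.pullback θ μ) (.pullback α ψ₂) k₁).trans hψ₂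
  have b₃ : ‖φ₂.1 (p₂ d) - μ.1 (π (p₂ d))‖ₑ ≤ r₂ :=
    (enorm_sub_le_mkDist φ₂ (.pullback π μ) k₂).trans hμ
  have b₄ : ‖μ.1 (π (p₂ d)) - μ.1 (θ (p₁ d))‖ₑ ≤ ENNReal.ofReal ε :=
    μ.enorm_apply_sub_apply_le (saMap π (saMap p₂ d)).2 (saMap θ (saMap p₁ d)).2
      (by rwa [norm_sub_rev])
  calc _ ≤ ‖s‖ₑ * r₁ + ‖t‖ₑ * (r₁ + r₂ + ENNReal.ofReal ε) := by
        refine (enorm_add_le _ _).trans ?_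
        rw [enorm_mul, enorm_mul]
        gcongr
        exact (enorm_add_le _ _).trans (add_le_add ((enorm_add_le _ _).trans
          (add_le_add b₂ b₃)) b₄)
    _ ≤ ‖s‖ₑ * (r₁ + r₂ + ENNReal.ofReal ε) + ‖t‖ₑ * (r₁ + r₂ + ENNReal.ofReal ε) := by
        gcongr
        rw [add_assoc]
        exact le_self_add
    _ = r₁ + r₂ + ENNReal.ofReal ε := by
        rw [← add_mul, enorm_add_enorm_of_nonneg hs ht, hst, enorm_one, one_mul]

theorem tunnelExtent_sumL_le [Nontrivial B] (hε : 0 < ε) :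
    tunnelExtent (sumL L₁ L₂ θ π ε) (α.comp (StarAlgHom.fst ℂ D₁ D₂))
      (β.comp (StarAlgHom.snd ℂ D₁ D₂)) ≤
      tunnelExtent L₁ α θ + tunnelExtent L₂ π β + ENNReal.ofReal ε := by
  -- A strict bound on a Hausdorff distance is needed to extract nearby states, so each extent gets
  -- a slack of `δ / 2`.
  refine ENNReal.le_of_forall_pos_le_add fun δ hδ hfin => ?_
  obtain ⟨hf₁, hf₂⟩ := ENNReal.add_lt_top.mp (ENNReal.add_lt_top.mp hfin).1
  have hδ' : ((δ / 2 : ℝ≥0) : ℝ≥0∞) ≠ 0 := by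
    rw [Ne, ENNReal.coe_eq_zero]
    positivity
  set r₁ := tunnelExtent L₁ α θ + (δ / 2 : ℝ≥0)
  set r₂ := tunnelExtent L₂ π β + (δ / 2 : ℝ≥0)
  have hr₁ : tunnelExtent L₁ α θ < r₁ := ENNReal.lt_add_right hf₁.ne hδ'
  have hr₂ : tunnelExtent L₂ π β < r₂ := ENNReal.lt_add_right hf₂.ne hδ'
  have hsum : r₁ + r₂ + ENNReal.ofReal ε =
      tunnelExtent L₁ α θ + tunnelExtent L₂ π β + ENNReal.ofReal ε + δ := by
    have : (δ : ℝ≥0∞) = (δ / 2 : ℝ≥0) + (δ / 2 : ℝ≥0) := by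
      rw [← ENNReal.coe_add, add_halves]
    rw [this]
    ring
  have hα := exists_mkDist_pullback_le_of_hausdorffEDist_lt ((le_max_left _ _).trans_lt hr₁)
  have hθ := exists_mkDist_pullback_le_of_hausdorffEDist_lt ((le_max_right _ _).trans_lt hr₁)
  have hπ := exists_mkDist_pullback_le_of_hausdorffEDist_lt ((le_max_left _ _).trans_lt hr₂)
  have hβ := exists_mkDist_pullback_le_of_hausdorffEDist_lt ((le_max_right _ _).trans_lt hr₂)
  -- This state only supplies the default values of the corners.
  obtain ⟨μ⟩ := StateSpace.instNonempty (A := B)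
  have hdec := fun φ : StateSpace (D₁ × D₂) =>
    StateSpace.apply_eq_corner_add_corner (.pullback θ μ) (.pullback π μ) φ
  have hl := fun φ : StateSpace (D₁ × D₂) => φ.apply_map_one_nonneg _ inl_star_mul_self
  have hr := fun φ : StateSpace (D₁ × D₂) => φ.apply_map_one_nonneg _ inr_star_mul_self
  have hone := fun φ : StateSpace (D₁ × D₂) => φ.apply_inl_one_add_apply_inr_one
  have hL := fun d => (sumL_le_one_iff (L₁ := L₁) (L₂ := L₂) (θ := θ) (π := π) hε d).mp
  rw [← hsum]
  refine max_le (hausdorffEDist_univ_range_pullback_le fun φ => ?_)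
    (hausdorffEDist_univ_range_pullback_le fun φ => ?_)
  · exact exists_mkDist_pullback_comp_le hL hα hπ (hl φ) (hr φ) (hone φ) (hdec φ)
  · rw [add_comm r₁]
    refine exists_mkDist_pullback_comp_le (p₁ := StarAlgHom.snd ℂ D₁ D₂)
      (p₂ := StarAlgHom.fst ℂ D₁ D₂) (θ := π) (π := θ) (fun d hd => ?_) hβ hθ (hr φ) (hl φ)
      ((add_comm _ _).trans (hone φ)) (fun d => (hdec φ d).trans (add_comm _ _))
    obtain ⟨k₁, k₂, k₃⟩ := hL d hd
    exact ⟨k₂, k₁, (norm_sub_rev _ _).trans_le k₃⟩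

end Extent

/-! ### The direct sum of the modules -/

section SumModule

variable {P R M : Type*} [NormedAddCommGroup P] [NormedSpace ℂ P] [NormedAddCommGroup R]
  [NormedSpace ℂ R] [NormedAddCommGroup M] [NormedSpace ℂ M]
  {D₁ : P → ℝ≥0∞} {D₂ : R → ℝ≥0∞} {Θ : P →ₗ[ℂ] M} {Ξ : R →ₗ[ℂ] M} {ε : ℝ}

theorem sumD_le_coe_iff (hε : 0 < ε) (ω : P × R) (r : ℝ≥0) :
    sumD D₁ D₂ Θ Ξ ε ω ≤ r ↔ D₁ ω.1 ≤ r ∧ D₂ ω.2 ≤ r ∧ ‖Θ ω.1 - Ξ ω.2‖ ≤ ε * r := by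
  rw [sumD, max_le_iff, max_le_iff, ofReal_inv_mul_norm_le_iff hε, and_assoc]

theorem sumD_ne_top_iff (ω : P × R) : sumD D₁ D₂ Θ Ξ ε ω ≠ ∞ ↔ D₁ ω.1 ≠ ∞ ∧ D₂ ω.2 ≠ ∞ := by
  simp [sumD, ← lt_top_iff_ne_top]

theorem sumD_add_le (h₁ : ∀ ω η, D₁ (ω + η) ≤ D₁ ω + D₁ η)
    (h₂ : ∀ ω η, D₂ (ω + η) ≤ D₂ ω + D₂ η) (hε : 0 < ε) (ω η : P × R) :
    sumD D₁ D₂ Θ Ξ ε (ω + η) ≤ sumD D₁ D₂ Θ Ξ ε ω + sumD D₁ D₂ Θ Ξ ε η := by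
  refine max_le (max_le ?_ ?_) ?_
  · exact (h₁ _ _).trans (add_le_add ((le_max_left _ _).trans (le_max_left _ _))
      ((le_max_left _ _).trans (le_max_left _ _)))
  · exact (h₂ _ _).trans (add_le_add ((le_max_right _ _).trans (le_max_left _ _))
      ((le_max_right _ _).trans (le_max_left _ _)))
  · refine le_trans ?_ (add_le_add (le_max_right _ _) (le_max_right _ _))
    rw [← ENNReal.ofReal_add (by positivity) (by positivity), ← mul_add]
    refine ENNReal.ofReal_le_ofReal (mul_le_mul_of_nonneg_left ?_ (by positivity))
    rw [Prod.fst_add, Prod.snd_add, map_add, map_add, add_sub_add_comm]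
    exact norm_add_le _ _

theorem sumD_smul (h₁ : ∀ (z : ℂ) ω, D₁ (z • ω) = ‖z‖ₑ * D₁ ω)
    (h₂ : ∀ (z : ℂ) ω, D₂ (z • ω) = ‖z‖ₑ * D₂ ω) (z : ℂ) (ω : P × R) :
    sumD D₁ D₂ Θ Ξ ε (z • ω) = ‖z‖ₑ * sumD D₁ D₂ Θ Ξ ε ω := by
  rw [sumD, sumD, Prod.smul_fst, Prod.smul_snd, h₁, h₂, map_smul, map_smul, ← smul_sub, norm_smul,
    mul_max, mul_max, mul_left_comm, ENNReal.ofReal_mul (norm_nonneg z), ofReal_norm]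

theorem dense_sumD_ne_top (h₁ : Dense {ω | D₁ ω ≠ ∞}) (h₂ : Dense {ω | D₂ ω ≠ ∞}) :
    Dense {ω | sumD D₁ D₂ Θ Ξ ε ω ≠ ∞} :=
  (h₁.prod h₂).mono fun ω hω => (sumD_ne_top_iff ω).mpr hω

theorem enorm_le_sumD (h₁ : ∀ ω, ‖ω‖ₑ ≤ D₁ ω) (h₂ : ∀ ω, ‖ω‖ₑ ≤ D₂ ω) (ω : P × R) :
    ‖ω‖ₑ ≤ sumD D₁ D₂ Θ Ξ ε ω := by
  rw [← ofReal_norm, Prod.norm_def, ENNReal.ofReal_max, ofReal_norm, ofReal_norm]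
  exact (max_le_max (h₁ _) (h₂ _)).trans (le_max_left _ _)

theorem isCompact_sumD_le_one (h₁ : IsCompact {ω | D₁ ω ≤ 1}) (h₂ : IsCompact {ω | D₂ ω ≤ 1})
    (hΘ : Continuous Θ) (hΞ : Continuous Ξ) : IsCompact {ω | sumD D₁ D₂ Θ Ξ ε ω ≤ 1} := by
  have e : {ω | sumD D₁ D₂ Θ Ξ ε ω ≤ 1} = ({ω | D₁ ω ≤ 1} ×ˢ {ω | D₂ ω ≤ 1}) ∩
      {ω : P × R | ENNReal.ofReal (1 / ε * ‖Θ ω.1 - Ξ ω.2‖) ≤ 1} := by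
    ext ω
    simp [sumD]
  rw [e]
  refine (h₁.prod h₂).inter_right (isClosed_le (ENNReal.continuous_ofReal.comp ?_)
    continuous_const)
  fun_prop

theorem sumD_le_of_eq {ω : P} {η : R} (h : Θ ω = Ξ η) {r : ℝ≥0∞} (hω : D₁ ω ≤ r)
    (hη : D₂ η ≤ r) : sumD D₁ D₂ Θ Ξ ε (ω, η) ≤ r := by
  refine max_le (max_le hω hη) ?_
  rw [h, sub_self, norm_zero, mul_zero, ENNReal.ofReal_zero]
  exact zero_le

end SumModule

/-! ### Metrized bundles and the composed tunnel -/

section Bundle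

variable {X : BundleData.{u₁, v₁}} {Y : BundleData.{u₂, v₂}} {θ : X.Alg →⋆ₐ[ℂ] Y.Alg}
  {Θ : X.Mod →ₗ[ℂ] Y.Mod}

theorem BundleData.norm_pairing_le (X : BundleData.{u, v}) (ω η : X.Mod) :
    ‖X.pairing ω η‖ ≤ ‖ω‖ * ‖η‖ :=
  (CStarModule.norm_inner_le X.Mod).trans_eq (mul_comm _ _)

theorem BundleData.norm_pairing_sub_le (X : BundleData.{u, v}) (ω ω' η η' : X.Mod) :
    ‖X.pairing ω η - X.pairing ω' η'‖ ≤ ‖ω - ω'‖ * ‖η‖ + ‖ω'‖ * ‖η - η'‖ := by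
  have e : X.pairing ω η - X.pairing ω' η' =
      X.pairing (ω - ω') η + X.pairing ω' (η - η') := by
    simp only [BundleData.pairing, CStarModule.inner_sub_left, CStarModule.inner_sub_right]
    abel
  rw [e]
  exact (norm_add_le _ _).trans (add_le_add (X.norm_pairing_le _ _) (X.norm_pairing_le _ _))

/-- The square of `‖Θ ω‖` is `‖θ ⟨ω, ω⟩‖`, and *-morphisms are contractive. Continuity of `Θ`, used
for compactness of the unit ball of the new D-norm, follows from this. -/
theorem IsModularIsometry.norm_apply_le (h : IsModularIsometry X Y θ Θ) (ω : X.Mod) :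
    ‖Θ ω‖ ≤ ‖ω‖ := by
  refine le_of_sq_le_sq ?_ (norm_nonneg _)
  rw [CStarModule.norm_sq_eq (A := Y.Alg), CStarModule.norm_sq_eq (A := X.Alg)]
  have := h.map_pairing ω ω
  simp only [BundleData.pairing] at this
  rw [← this]
  exact NonUnitalStarAlgHom.norm_apply_le θ _

theorem IsModularIsometry.continuous (h : IsModularIsometry X Y θ Θ) : Continuous Θ :=
  AddMonoidHomClass.continuous_of_bound Θ 1 fun ω => by simpa using h.norm_apply_le ω

theorem IsModularIsometry.le (h : IsModularIsometry X Y θ Θ) (ω : X.Mod) :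
    Y.D (Θ ω) ≤ X.D ω := by
  rw [h.quotient]
  exact iInf_fiber_le ω rfl

theorem IsModularIsometry.exists_lt (h : IsModularIsometry X Y θ Θ) {η : Y.Mod}
    {r : ℝ≥0∞} (hr : Y.D η < r) : ∃ ω, Θ ω = η ∧ X.D ω < r := by
  rw [h.quotient] at hr
  simpa only [iInf_lt_iff, exists_prop] using hr

variable {F : ℝ≥0 → ℝ≥0 → ℝ≥0 → ℝ≥0 → ℝ≥0} {H : ℝ≥0 → ℝ≥0 → ℝ≥0}

theorem IsMetrizedBundle.inner_leibniz_mono (hX : IsMetrizedBundle F H X)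
    (hFH : IsPermissiblePair F H) {ω η : X.Mod} {r s : ℝ≥0} (hω : X.D ω ≤ r) (hη : X.D η ≤ s) :
    X.L (ℜ (X.pairing ω η)) ≤ H r s ∧ X.L (ℑ (X.pairing ω η)) ≤ H r s :=
  max_le_iff.mp ((hX.inner_leibniz ω η (ne_top_of_le_ne_top ENNReal.coe_ne_top hω)
    (ne_top_of_le_ne_top ENNReal.coe_ne_top hη)).trans (ENNReal.coe_le_coe.mpr
      (hFH.mono _ _ _ _ (toNNReal_le_of_le_coe hω) (toNNReal_le_of_le_coe hη))))

theorem IsMetrizedBundle.norm_le_of_le (hX : IsMetrizedBundle F H X) {ω : X.Mod} {r : ℝ≥0}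
    (h : X.D ω ≤ r) : ‖ω‖ ≤ r := by
  have := (hX.norm_le ω).trans h
  rwa [← ofReal_norm, ENNReal.ofReal_le_coe] at this

variable {A : BundleData.{u₁, v₁}} {B : BundleData.{u₂, v₂}} {E : BundleData.{u₃, v₃}}
  {τ₁ : TunnelData.{u, v} A B} {τ₂ : TunnelData.{u₄, v₄} B E} {ε : ℝ}

/-- The two components follow from monotonicity of `H`. For the bridge term, both pairings are
pushed to the module of `B` and compared there. -/
theorem sumBundle_inner_leibniz (hFH : IsPermissiblePair F H) (h₁ : IsModularTunnel F H τ₁)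
    (h₂ : IsModularTunnel F H τ₂) (hε : 0 < ε) (ω η : (τ₁.sumBundle τ₂ ε).Mod)
    (hω : (τ₁.sumBundle τ₂ ε).D ω ≠ ∞) (hη : (τ₁.sumBundle τ₂ ε).D η ≠ ∞) :
    max ((τ₁.sumBundle τ₂ ε).L (ℜ ((τ₁.sumBundle τ₂ ε).pairing ω η)))
      ((τ₁.sumBundle τ₂ ε).L (ℑ ((τ₁.sumBundle τ₂ ε).pairing ω η))) ≤
      (H ((τ₁.sumBundle τ₂ ε).D ω).toNNReal ((τ₁.sumBundle τ₂ ε).D η).toNNReal : ℝ≥0∞) := by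
  obtain ⟨r, hr⟩ := exists_eq_coe_of_ne_top hω
  obtain ⟨s, hs⟩ := exists_eq_coe_of_ne_top hη
  rw [← hr, ← hs, ENNReal.toNNReal_coe, ENNReal.toNNReal_coe]
  obtain ⟨ω₁, ω₂⟩ := ω
  obtain ⟨η₁, η₂⟩ := η
  obtain ⟨hω₁, hω₂, hω₃⟩ := (sumD_le_coe_iff hε (ω₁, ω₂) r).mp hr.ge
  obtain ⟨hη₁, hη₂, hη₃⟩ := (sumD_le_coe_iff hε (η₁, η₂) s).mp hs.ge
  dsimp only at hω₁ hω₂ hω₃ hη₁ hη₂ hη₃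
  obtain ⟨hr₁, hi₁⟩ := h₁.bundle.inner_leibniz_mono hFH hω₁ hη₁
  obtain ⟨hr₂, hi₂⟩ := h₂.bundle.inner_leibniz_mono hFH hω₂ hη₂
  have hnorm : ‖τ₁.algSnd (τ₁.bundle.pairing ω₁ η₁) - τ₂.algFst (τ₂.bundle.pairing ω₂ η₂)‖ ≤
      ε * (H r s) := by
    rw [h₁.snd.map_pairing, h₂.fst.map_pairing]
    have n₁ := (h₁.snd.norm_apply_le η₁).trans (h₁.bundle.norm_le_of_le hη₁)
    have n₂ := (h₂.fst.norm_apply_le ω₂).trans (h₂.bundle.norm_le_of_le hω₂)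
    have hH : (2 : ℝ) * r * s ≤ H r s := by exact_mod_cast hFH.bound r s
    calc _ ≤ _ := B.norm_pairing_sub_le _ _ _ _
      -- Norms are dominated by D-norms, so each variable contributes `ε r s`; this is the origin of
      -- the 2 in `2 x y ≤ H x y`.
      _ ≤ (ε * r) * s + r * (ε * s) := by gcongr
      _ = ε * (2 * r * s) := by ring
      _ ≤ ε * H r s := by gcongr
  let x : τ₁.bundle.Alg × τ₂.bundle.Alg :=
    (τ₁.bundle.pairing ω₁ η₁, τ₂.bundle.pairing ω₂ η₂)
  change max (sumL τ₁.bundle.L τ₂.bundle.L τ₁.algSnd τ₂.algFst ε (ℜ x))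
    (sumL τ₁.bundle.L τ₂.bundle.L τ₁.algSnd τ₂.algFst ε (ℑ x)) ≤ _
  refine max_le ((sumL_le_coe_iff hε _ _).mpr ⟨?_, ?_, ?_⟩)
    ((sumL_le_coe_iff hε _ _).mpr ⟨?_, ?_, ?_⟩)
  · rw [saMap_realPart]
    exact hr₁
  · rw [saMap_realPart]
    exact hr₂
  · change ‖((saMap (τ₁.algSnd.comp (StarAlgHom.fst ℂ _ τ₂.bundle.Alg)) (ℜ x) :
      selfAdjoint B.Alg) : B.Alg) - (saMap (τ₂.algFst.comp (StarAlgHom.snd ℂ τ₁.bundle.Alg _))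
      (ℜ x) : selfAdjoint B.Alg)‖ ≤ _
    rw [saMap_realPart, saMap_realPart]
    exact (norm_realPart_sub_le _ _).trans hnorm
  · rw [saMap_imaginaryPart]
    exact hi₁
  · rw [saMap_imaginaryPart]
    exact hi₂
  · change ‖((saMap (τ₁.algSnd.comp (StarAlgHom.fst ℂ _ τ₂.bundle.Alg)) (ℑ x) :
      selfAdjoint B.Alg) : B.Alg) - (saMap (τ₂.algFst.comp (StarAlgHom.snd ℂ τ₁.bundle.Alg _))
      (ℑ x) : selfAdjoint B.Alg)‖ ≤ _
    rw [saMap_imaginaryPart, saMap_imaginaryPart]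
    exact (norm_imaginaryPart_sub_le _ _).trans hnorm

theorem isMetrizedBundle_sumBundle (hFH : IsPermissiblePair F H) (hB : IsMetrizedBundle F H B)
    (h₁ : IsModularTunnel F H τ₁) (h₂ : IsModularTunnel F H τ₂) (hε : 0 < ε) :
    IsMetrizedBundle F H (τ₁.sumBundle τ₂ ε) where
  base := have := hB.base.nontrivial
    isQuantumCompactMetricSpace_sumL hFH.fst h₁.bundle.base h₂.bundle.base hε
  add_le := sumD_add_le h₁.bundle.add_le h₂.bundle.add_le hε
  smul := sumD_smul h₁.bundle.smul h₂.bundle.smul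
  dense_dom := dense_sumD_ne_top h₁.bundle.dense_dom h₂.bundle.dense_dom
  norm_le := enorm_le_sumD h₁.bundle.norm_le h₂.bundle.norm_le
  compact_ball := isCompact_sumD_le_one h₁.bundle.compact_ball h₂.bundle.compact_ball
    h₁.snd.continuous h₂.fst.continuous
  inner_leibniz := sumBundle_inner_leibniz hFH h₁ h₂ hε

/-- The D-norm is handled by the lifting argument used for the bases: `η` is paired with an almost
optimal lift `ζ` of its image in the module of `B`. -/
theorem isModularIsometry_compose_fst (h₁ : IsModularTunnel F H τ₁)
    (h₂ : IsModularTunnel F H τ₂) :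
    IsModularIsometry (τ₁.sumBundle τ₂ ε) A (τ₁.compose τ₂ ε).algFst
      (τ₁.compose τ₂ ε).modFst where
  map_smul a ω := h₁.fst.map_smul a.1 ω.1
  map_pairing ω η := h₁.fst.map_pairing ω.1 η.1
  base := isQuantumIsometry_sumL_fst h₁.fst.base h₁.snd.base h₂.fst.base
  surjective := h₁.fst.surjective.comp Prod.fst_surjective
  quotient ω := by
    refine le_antisymm (le_iInf₂ ?_) ?_
    · rintro η rfl
      exact (h₁.fst.le η.1).trans ((le_max_left _ _).trans (le_max_left _ _))
    · rw [h₁.fst.quotient]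
      refine le_iInf₂ ?_
      rintro η rfl
      refine le_of_forall_gt fun r hr => ?_
      obtain ⟨q, hq, hqr⟩ := exists_between hr
      obtain ⟨ζ, hζ, hζr⟩ := h₂.fst.exists_lt ((h₁.snd.le η).trans_lt hq)
      refine (iInf_fiber_le (η, ζ) rfl).trans_lt ?_
      exact (sumD_le_of_eq hζ.symm hq.le hζr.le).trans_lt hqr

theorem isModularIsometry_compose_snd (h₁ : IsModularTunnel F H τ₁)
    (h₂ : IsModularTunnel F H τ₂) :
    IsModularIsometry (τ₁.sumBundle τ₂ ε) E (τ₁.compose τ₂ ε).algSnd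
      (τ₁.compose τ₂ ε).modSnd where
  map_smul a ω := h₂.snd.map_smul a.2 ω.2
  map_pairing ω η := h₂.snd.map_pairing ω.2 η.2
  base := isQuantumIsometry_sumL_snd h₁.snd.base h₂.fst.base h₂.snd.base
  surjective := h₂.snd.surjective.comp Prod.snd_surjective
  quotient ω := by
    refine le_antisymm (le_iInf₂ ?_) ?_
    · rintro η rfl
      exact (h₂.snd.le η.2).trans ((le_max_right _ _).trans (le_max_left _ _))
    · rw [h₂.snd.quotient]
      refine le_iInf₂ ?_
      rintro η rfl
      refine le_of_forall_gt fun r hr => ?_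
      obtain ⟨q, hq, hqr⟩ := exists_between hr
      obtain ⟨ζ, hζ, hζr⟩ := h₁.snd.exists_lt ((h₂.fst.le η).trans_lt hq)
      refine (iInf_fiber_le (ζ, η) rfl).trans_lt ?_
      exact (sumD_le_of_eq hζ hζr.le hq.le).trans_lt hqr

end Bundle

end

theorem mainTheorem6
    (F : ℝ≥0 → ℝ≥0 → ℝ≥0 → ℝ≥0 → ℝ≥0) (H : ℝ≥0 → ℝ≥0 → ℝ≥0) (hFH : IsPermissiblePair F H)
    (A : BundleData.{u₁, v₁}) (B : BundleData.{u₂, v₂}) (E : BundleData.{u₃, v₃})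
    (hA : IsMetrizedBundle F H A) (hB : IsMetrizedBundle F H B) (hE : IsMetrizedBundle F H E)
    (τ₁ : TunnelData.{u, v} A B) (τ₂ : TunnelData.{u₄, v₄} B E)
    (hτ₁ : IsModularTunnel F H τ₁) (hτ₂ : IsModularTunnel F H τ₂)
    (ε : ℝ) (hε : 0 < ε) :
    IsMetrizedBundle F H (τ₁.sumBundle τ₂ ε) ∧
      IsModularTunnel F H (τ₁.compose τ₂ ε) ∧
      (τ₁.compose τ₂ ε).extent ≤ τ₁.extent + τ₂.extent + ENNReal.ofReal ε := by
  have hτ := isMetrizedBundle_sumBundle hFH hB hτ₁ hτ₂ hε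
  have := hB.base.nontrivial
  exact ⟨hτ, ⟨hτ, isModularIsometry_compose_fst hτ₁ hτ₂, isModularIsometry_compose_snd hτ₁ hτ₂⟩,
    tunnelExtent_sumL_le hε⟩
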